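/- For a $(0,1)$-matrix $A$ and a $(0,1)$-matrix $F$, say that $A$ has $F$ as a configuration if some submatrix of $A$ is a row and column permutation of $F$. Let $q\cdot(\mathbf 1_2\mathbf 0_2)$ denote the $4\times q$ matrix all of whose columns are $(1,1,0,0)^{T}$. A matrix is simple if it is a $(0,1)$-matrix with no repeated columns, and $\mathrm{forb}(m,F)$ is the smallest $N$ such that every simple $m$-rowed matrix with no configuration $F$ has at most $N$ columns. A 2-design $S_\lambda(2,3,m)$ is a family of $\frac{\lambda}{3}\binom m2$ triples from $[m]=\{1,\dots,m\}$, repetitions allowed, such that every pair of distinct points lies in exactly $\lambda$ of the triples (so $S_0(2,3,m)$ is the empty family). Let $q>2$ be an integer. There is a constant $M=M(q)$ such that the following holds for every $m>M$. Let $A$ be an $m\times n$ $(0,1)$-matrix in which no column of sum $0,1,2,m-2,m-1$ or $m$ is repeated and which has no configuration $q\cdot(\mathbf 1_2\mathbf 0_2)$. Then $$n\le 2m+2+\frac{q+3}{3}\binom m2 .$$ If $m\equiv 1,3\pmod 6$, then this bound is attained, even by a simple matrix, so that $\mathrm{forb}(m,q\cdot(\mathbf 1_2\mathbf 0_2))=2m+2+\frac{q+3}{3}\binom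 m2$. Moreover, if $m\equiv 1,3\pmod 6$ and $n=\mathrm{forb}(m,q\cdot(\mathbf 1_2\mathbf 0_2))$, then $A$ contains every possible column of sum $0,1,2,m-2,m-1,m$ exactly once, and there are integers $a,b\ge 0$ with $a+b=q-3$ such that the columns of $A$ of sum $3$ are the incidence vectors of the triples of an $S_a(2,3,m)$, the columns of $A$ of sum $m-3$ are the incidence vectors of the complements in $[m]$ of the triples of an $S_b(2,3,m)$, and $A$ has no further columns. -/

import Mathlib

namespace ForbConfig

open Finset

/-- `q` copies of the column consisting of `k` ones above `l` zeros, as a `(k + l) × q` matrix. -/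
def copies (q k l : ℕ) : Matrix (Fin (k + l)) (Fin q) (Fin 2) :=
  fun i _ => if (i : ℕ) < k then 1 else 0

/-- The `(0,1)`-matrix `A` has `F` as a configuration: some submatrix of `A` is a row and column
permutation of `F`. -/
def HasConfiguration {m n k l : ℕ} (A : Matrix (Fin m) (Fin n) (Fin 2))
    (F : Matrix (Fin k) (Fin l) (Fin 2)) : Prop :=
  ∃ (r : Fin k ↪ Fin m) (c : Fin l ↪ Fin n), A.submatrix r c = F

/-- A simple matrix is a `(0,1)`-matrix with no repeated columns. -/
def IsSimple {m n : ℕ} (A : Matrix (Fin m) (Fin n) (Fin 2)) : Prop :=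
  ∀ j k : Fin n, (∀ i, A i j = A i k) → j = k

/-- `forb m F` is the least `N` such that every simple `m`-rowed matrix with no configuration `F`
has at most `N` columns. -/
noncomputable def forb (m : ℕ) {k l : ℕ} (F : Matrix (Fin k) (Fin l) (Fin 2)) : ℕ :=
  sInf {N : ℕ | ∀ (n : ℕ) (A : Matrix (Fin m) (Fin n) (Fin 2)),
    IsSimple A → ¬ HasConfiguration A F → n ≤ N}

/-- The sum of a `(0,1)`-column. -/
def colSum {m : ℕ} (v : Fin m → Fin 2) : ℕ := ∑ i, (v i : ℕ)

/-- The set of rows in which a `(0,1)`-column has a one. -/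
def support {m : ℕ} (v : Fin m → Fin 2) : Finset (Fin m) := {i | v i = 1}

/-- The column sums `0, 1, 2, m - 2, m - 1, m`. -/
def extremeSums (m : ℕ) : Finset ℕ := {0, 1, 2, m - 2, m - 1, m}

/-- No column of sum `0, 1, 2, m - 2, m - 1` or `m` is repeated. -/
def NoRepeatedExtremeColumn {m n : ℕ} (A : Matrix (Fin m) (Fin n) (Fin 2)) : Prop :=
  ∀ j k : Fin n, colSum (fun i => A i j) ∈ extremeSums m → (∀ i, A i j = A i k) → j = k

/-- A 2-design `S_lam(2,3,v)` (blocks may be repeated): a family of `(lam / 3) * (v choose 2)`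
triples from the `v` points such that every pair of points lies in exactly `lam` of them. -/
structure IsTripleSystem (lam v : ℕ) (T : Multiset (Finset (Fin v))) : Prop where
  card_block : ∀ B ∈ T, #B = 3
  card_eq : 3 * Multiset.card T = lam * v.choose 2
  pair_count : ∀ i j : Fin v, i ≠ j → T.countP (fun B => i ∈ B ∧ j ∈ B) = lam

/-- The multiset of the supports of the columns of `A` of column sum `s`. -/
def columnSets {m n : ℕ} (A : Matrix (Fin m) (Fin n) (Fin 2)) (s : ℕ) :
    Multiset (Finset (Fin m)) :=
  ({j | colSum (fun i => A i j) = s} : Finset (Fin n)).val.map fun j => support fun i => A i j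

/-- `A` consists of all columns of sum `0, 1, 2, m - 2, m - 1, m` once each, of columns of sum `3`
corresponding to the triples of an `S_a(2,3,m)`, of columns of sum `m - 3` corresponding to the
complements of the triples of an `S_b(2,3,m)`, where `a + b = q - 3`, and of no further columns. -/
def IsDesignMatrix (q : ℕ) {m n : ℕ} (A : Matrix (Fin m) (Fin n) (Fin 2)) : Prop :=
  (∀ v : Fin m → Fin 2, colSum v ∈ extremeSums m → ∃! j, (fun i => A i j) = v) ∧
  (∃ a b : ℕ, a + b + 3 = q ∧
    IsTripleSystem a m (columnSets A 3) ∧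
    IsTripleSystem b m ((columnSets A (m - 3)).map fun s => sᶜ)) ∧
  ∀ j, colSum (fun i => A i j) ∈ extremeSums m ∪ {3, m - 3}

end ForbConfig

/-! Let `N = m.choose 2`, and view a column as the set `S` of its ones. It splits `(P, Q)` when the
pair `P` lies in `S` and the pair `Q` in its complement. Avoiding the configuration means that
disjoint `P`, `Q` are split by at most `q - 1` columns. Counting split pairs with equal weights is
not sharp: a triple splits only `3 * (m - 3).choose 2` of them instead of `3 * N`.

The remedy is a weight `w` that depends on the matrix. It vanishes unless `P` and `Q` are separated
(`Separated`), is at least 1 on separated pairs, and has all row and column sums equal to `N`. Few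
pairs are not separated (`card_not_separated_le`), so Hall's theorem can move their unit weights to
separated positions (`exists_weight`).

With this weight, a column of sum 3 or `m - 3` covers exactly `3 * N`, one of sum 2 or `m - 2`
covers `N`, and the columns of sum 0, 1, `m - 1`, `m` cover nothing. Every other column covers
strictly more than `3 * N`. The total covered is at most `(q - 1) * N * N`. The extreme columns,
being unrepeated, fall short by at most `N * (6 * (m + 1) + 4 * N)` in all (`sum_defect`), and
division by `N` gives the bound (`card_bound`).

Equality forces every extreme column to occur, all other columns to have sum 3 or `m - 3`, and every
separated pair to be split exactly `q - 1` times. For separated `P`, `Q` the number of triples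
through `P` plus the number of complementary triples through `Q` is then `q - 3`. Any two pairs `P`,
`P'` have a common separated `Q`, so both degrees are constant and the triples form designs.

The bound is attained by adding to the extreme columns `q - 3` pairwise disjoint Steiner triple
systems. These are Bose or Skolem systems on three levels, with level `i` translated by `k * i` in
the `k`-th system. -/

namespace ForbConfig
open Finset

/-! ### Redistributing weight by Hall's theorem -/

/-- Hall's theorem for bipartite graphs on equal sides whose complement has degrees at most `C`. -/
theorem exists_perm_of_few_bad {ε : Type*} [Fintype ε] [DecidableEq ε] (r : ε → ε → Prop)
    [∀ a b, Decidable (r a b)] (C : ℕ) (hrow : ∀ a, #{b | ¬ r a b} ≤ C)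
    (hcol : ∀ b, #{a | ¬ r a b} ≤ C) (hC : 2 * C ≤ Fintype.card ε) :
    ∃ f : ε ≃ ε, ∀ a, r a (f a) := by
  have hall : ∀ s : Finset ε, #s ≤ #(s.biUnion fun a => ({b | r a b} : Finset ε)) := by
    intro s
    rcases s.eq_empty_or_nonempty with rfl | ⟨a, ha⟩
    · simp
    by_cases hs : #s ≤ C
    · have h1 : #({b | r a b} : Finset ε) ≤ #(s.biUnion fun a => ({b | r a b} : Finset ε)) :=
        card_le_card (subset_biUnion_of_mem (fun a => ({b | r a b} : Finset ε)) ha)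
      have h2 := card_filter_add_card_filter_not (s := (univ : Finset ε)) (fun b => r a b)
      have h3 := hrow a
      rw [card_univ] at h2
      omega
    · have : s.biUnion (fun a => ({b | r a b} : Finset ε)) = univ := by
        ext b
        simp only [mem_biUnion, mem_filter, mem_univ, true_and, iff_true]
        by_contra! hb
        exact hs ((card_le_card fun a ha => by simpa using hb a ha).trans (hcol b))
      rw [this]
      exact card_le_univ s
  obtain ⟨f, hf, hr⟩ := (all_card_le_biUnion_card_iff_exists_injective _).1 hall
  exact ⟨Equiv.ofBijective f (Finite.injective_iff_bijective.1 hf), fun a => by simpa using hr a⟩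

/-- A dense bipartite graph carries a natural-valued weight, at least one on each edge, all of whose
row and column sums are those of the complete bipartite graph. -/
theorem exists_weight {α : Type*} [Fintype α] [DecidableEq α] (good : α → α → Prop)
    [∀ a b, Decidable (good a b)] (B : ℕ) (hrow : ∀ a, #{b | ¬ good a b} ≤ B)
    (hcol : ∀ b, #{a | ¬ good a b} ≤ B) (hB : 2 * (B * B) ≤ #{e : α × α | ¬ good e.1 e.2}) :
    ∃ w : α → α → ℕ, (∀ a b, ¬ good a b → w a b = 0) ∧ (∀ a b, good a b → 1 ≤ w a b) ∧
      (∀ a, ∑ b, w a b = Fintype.card α) ∧ ∀ b, ∑ a, w a b = Fintype.card α := by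
  let ε := {e : α × α // ¬ good e.1 e.2}
  have card_row : ∀ a, #{e : ε | e.1.1 = a} = #{b | ¬ good a b} := by
    intro a
    refine card_bij' (fun e _ => e.1.2) (fun b hb => ⟨(a, b), by simpa using hb⟩) ?_ ?_ ?_ ?_
    · rintro ⟨⟨x, y⟩, h⟩ he
      simp only [mem_filter, mem_univ, true_and] at he ⊢
      subst he; exact h
    · intro b hb; simp
    · rintro ⟨⟨x, y⟩, h⟩ he
      simp only [mem_filter, mem_univ, true_and] at he
      subst he; rfl
    · intro b hb; rfl
  have card_col : ∀ b, #{e : ε | e.1.2 = b} = #{a | ¬ good a b} := by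
    intro b
    refine card_bij' (fun e _ => e.1.1) (fun a ha => ⟨(a, b), by simpa using ha⟩) ?_ ?_ ?_ ?_
    · rintro ⟨⟨x, y⟩, h⟩ he
      simp only [mem_filter, mem_univ, true_and] at he ⊢
      subst he; exact h
    · intro b hb; simp
    · rintro ⟨⟨x, y⟩, h⟩ he
      simp only [mem_filter, mem_univ, true_and] at he
      subst he; rfl
    · intro b hb; rfl
  -- Non-edges are permuted so that the row of `e` and the column of `f e` meet in an edge. A row
  -- misses at most `B` columns, each containing at most `B` non-edges, which gives the constant `B
  -- * B`.
  obtain ⟨f, hf⟩ := exists_perm_of_few_bad (ε := ε) (fun e e' => good e.1.1 e'.1.2) (B * B)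
    (by
      intro e
      have : ({e' : ε | ¬ good e.1.1 e'.1.2} : Finset ε) ⊆
          ({b | ¬ good e.1.1 b} : Finset α).biUnion fun b => {e' : ε | e'.1.2 = b} := by
        intro e' he'
        simpa using he'
      refine (card_le_card this).trans ((card_biUnion_le_card_mul _ _ B ?_).trans
        (Nat.mul_le_mul_right _ (hrow _)))
      intro b _
      exact (card_col b).le.trans (hcol b))
    (by
      intro e'
      have : ({e : ε | ¬ good e.1.1 e'.1.2} : Finset ε) ⊆
          ({a | ¬ good a e'.1.2} : Finset α).biUnion fun a => {e : ε | e.1.1 = a} := by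
        intro e he
        simpa using he
      refine (card_le_card this).trans ((card_biUnion_le_card_mul _ _ B ?_).trans
        (Nat.mul_le_mul_right _ (hcol _)))
      intro a _
      exact (card_row a).le.trans (hrow a))
    (by rw [Fintype.card_subtype]; exact hB)
  -- The unit weight of each non-edge `e` moves to the edge in the row of `e` and the column of `f
  -- e`. Row sums are preserved because `e` keeps its row, column sums because `f` is a bijection.
  refine ⟨fun a b => (if good a b then 1 else 0) + #{e : ε | e.1.1 = a ∧ (f e).1.2 = b},
    ?_, ?_, ?_, ?_⟩
  · intro a b h
    simp only [h, if_false, zero_add, card_eq_zero, filter_eq_empty_iff, mem_univ, true_implies]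
    rintro e ⟨rfl, rfl⟩
    exact h (hf e)
  · intro a b h
    simp [h]
  · intro a
    rw [sum_add_distrib]
    have h1 : ∑ b, #{e : ε | e.1.1 = a ∧ (f e).1.2 = b} = #{e : ε | e.1.1 = a} := by
      rw [card_eq_sum_card_fiberwise (f := fun e => (f e).1.2) (t := univ) (fun _ _ => by simp)]
      simp [filter_filter]
    rw [h1, card_row, ← card_filter, card_filter_add_card_filter_not, card_univ]
  · intro b
    rw [sum_add_distrib]
    have h1 : ∑ a, #{e : ε | e.1.1 = a ∧ (f e).1.2 = b} = #{e : ε | (f e).1.2 = b} := by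
      rw [card_eq_sum_card_fiberwise (f := fun e => e.1.1) (t := univ) (fun _ _ => by simp)]
      simp [filter_filter, and_comm]
    have h2 : #{e : ε | (f e).1.2 = b} = #{e : ε | e.1.2 = b} :=
      card_equiv f (by simp)
    rw [h1, h2, card_col, ← card_filter, card_filter_add_card_filter_not, card_univ]

/-! ### Pairs covered by a set -/

section Pairs

variable {V : Type*} [Fintype V] [DecidableEq V]

/-- The two-element subsets of `V`. -/
abbrev Pair (V : Type*) := {P : Finset V // #P = 2}

theorem card_pairs_subset (U : Finset V) : #{P : Pair V | P.1 ⊆ U} = (#U).choose 2 := by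
  rw [← card_powersetCard]
  refine card_bij' (fun P _ => P.1) (fun P hP => ⟨P, (mem_powersetCard.1 hP).2⟩) ?_ ?_ ?_ ?_
  · intro P hP
    simpa [mem_powersetCard, P.2] using hP
  · intro P hP
    simpa using (mem_powersetCard.1 hP).1
  · intro P hP; rfl
  · intro P hP; rfl

omit [DecidableEq V] in
theorem card_pairs : Fintype.card (Pair V) = (Fintype.card V).choose 2 := by
  simp

/-- The total weight of the pairs of pairs `(P, Q)` with `P` inside and `Q` outside `U`. -/
def cover (w : Pair V → Pair V → ℕ) (U : Finset V) : ℕ :=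
  ∑ P, ∑ Q, if P.1 ⊆ U ∧ Q.1 ⊆ Uᶜ then w P Q else 0

theorem cover_compl (w : Pair V → Pair V → ℕ) (U : Finset V) :
    cover (fun P Q => w Q P) Uᶜ = cover w U := by
  unfold cover
  rw [sum_comm]
  simp only [compl_compl, and_comm]

theorem cover_eq_sum (w : Pair V → Pair V → ℕ) (U : Finset V) :
    cover w U = ∑ P : Pair V with P.1 ⊆ U, ∑ Q : Pair V with Q.1 ⊆ Uᶜ, w P Q := by
  unfold cover
  rw [sum_filter]
  refine sum_congr rfl fun P _ => ?_
  by_cases h : P.1 ⊆ U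
  · simp [h, sum_filter]
  · simp [h]

/-- When every good partner of a pair inside `U` lies outside `U`, the condition on `Q` discards no
weight, so each pair inside `U` contributes its full row sum. -/
theorem cover_eq {w : Pair V → Pair V → ℕ} {good : Pair V → Pair V → Prop} {N : ℕ}
    (h0 : ∀ P Q, ¬ good P Q → w P Q = 0) (hrow : ∀ P, ∑ Q, w P Q = N) {U : Finset V}
    (hU : ∀ P Q : Pair V, P.1 ⊆ U → good P Q → Q.1 ⊆ Uᶜ) :
    cover w U = (#U).choose 2 * N := by
  rw [cover_eq_sum, ← card_pairs_subset, ← smul_eq_mul, ← sum_const]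
  refine sum_congr rfl fun P hP => ?_
  rw [← hrow P]
  refine sum_subset (subset_univ _) fun Q _ hQ => h0 P Q fun hg => ?_
  exact hQ (by simpa using hU P Q (by simpa using hP) hg)

/-- For each `P` inside `U`, all but at most `B` of the pairs outside `U` are good partners, each of
weight at least 1. -/
theorem le_cover {w : Pair V → Pair V → ℕ} {good : Pair V → Pair V → Prop}
    [∀ P Q, Decidable (good P Q)] {B : ℕ} (h1 : ∀ P Q, good P Q → 1 ≤ w P Q)
    (hrow : ∀ P, #{Q | ¬ good P Q} ≤ B) (U : Finset V) :
    (#U).choose 2 * ((Fintype.card V - #U).choose 2 - B) ≤ cover w U := by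
  rw [cover_eq_sum, ← card_pairs_subset, ← smul_eq_mul, ← sum_const]
  refine sum_le_sum fun P _ => ?_
  have h2 : #({Q : Pair V | Q.1 ⊆ Uᶜ} : Finset (Pair V)) ≤
      #({Q : Pair V | Q.1 ⊆ Uᶜ ∧ good P Q} : Finset (Pair V)) + #{Q | ¬ good P Q} := by
    refine (card_le_card ?_).trans (card_union_le _ _)
    intro Q hQ
    by_cases h : good P Q <;> simp_all
  rw [card_pairs_subset, card_compl] at h2
  have h3 := hrow P
  have h4 : #({Q : Pair V | Q.1 ⊆ Uᶜ ∧ good P Q} : Finset (Pair V)) ≤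
      ∑ Q : Pair V with Q.1 ⊆ Uᶜ, w P Q := by
    rw [card_eq_sum_ones]
    calc ∑ Q : Pair V with Q.1 ⊆ Uᶜ ∧ good P Q, 1
        ≤ ∑ Q : Pair V with Q.1 ⊆ Uᶜ ∧ good P Q, w P Q :=
          sum_le_sum fun Q hQ => h1 P Q (by simpa using (mem_filter.1 hQ).2.2)
      _ ≤ _ := sum_le_sum_of_subset (by
          intro Q hQ; simp at hQ ⊢; exact hQ.1)
  omega

/-- Sets with at least four elements and at most half of the points cover more than three times. -/
theorem three_mul_lt_choose_mul {q m s : ℕ} (hq : 1 ≤ q) (hm : 1000 * q ^ 2 < m) (hs : 4 ≤ s)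
    (hsm : 2 * s ≤ m) :
    3 * m.choose 2 < s.choose 2 * ((m - s).choose 2 - 11 * q * m) := by
  have two_mul_choose : ∀ n : ℕ, (2 : ℝ) * (n.choose 2 : ℕ) = n * (n - 1) := by
    intro n
    rw [Nat.cast_choose_two]; ring
  obtain ⟨d, rfl⟩ := Nat.exists_eq_add_of_le (show s ≤ m by omega)
  simp only [Nat.add_sub_cancel_left]
  have hq' : (1 : ℝ) ≤ q := by exact_mod_cast hq
  have hm' : (1000 : ℝ) * q ^ 2 < s + d := by exact_mod_cast hm
  have hqm : (1000 : ℝ) * q < s + d := by nlinarith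
  have hd : (s : ℝ) ≤ d := by exact_mod_cast (show s ≤ d by omega)
  have hs' : (4 : ℝ) ≤ s := by exact_mod_cast hs
  have e1 := two_mul_choose s
  have e2 := two_mul_choose d
  have e3 := two_mul_choose (s + d)
  set x : ℝ := ((s.choose 2 : ℕ) : ℝ)
  set y : ℝ := ((d.choose 2 : ℕ) : ℝ)
  set z : ℝ := (((s + d).choose 2 : ℕ) : ℝ)
  have key : (3 : ℝ) * z < x * (y - 11 * q * (s + d)) := by
    push_cast at e3
    have hpos : 0 < y - 11 * q * (s + d) := by nlinarith
    -- For `s ≥ 8` the factor 28 makes up for `d` being possibly only half of `s + d`. For `s < 8`,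
    -- `d` is nearly all of `s + d` and the factor 6 suffices.
    rcases le_or_gt (8 : ℝ) s with h8 | h8
    · have hx : 28 ≤ x := by nlinarith
      have : 3 * z < 28 * (y - 11 * q * (s + d)) := by nlinarith
      nlinarith
    · have hx : 6 ≤ x := by nlinarith
      have : 3 * z < 6 * (y - 11 * q * (s + d)) := by nlinarith
      nlinarith
  have hle : 11 * q * (s + d) ≤ d.choose 2 := by
    have : (11 : ℝ) * q * (s + d) ≤ ((d.choose 2 : ℕ) : ℝ) := by nlinarith
    exact_mod_cast this
  have : ((3 * (s + d).choose 2 : ℕ) : ℝ) <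
      ((s.choose 2 * (d.choose 2 - 11 * q * (s + d)) : ℕ) : ℝ) := by
    push_cast [Nat.cast_sub hle]
    exact key
  exact_mod_cast this

end Pairs

/-! ### Separated pairs -/

section Columns

variable {V : Type*} [Fintype V] [DecidableEq V] {ι : Type*} [Fintype ι]

/-- The number of sets of the family that contain `P` and avoid `Q`. -/
def splitCount (S : ι → Finset V) (P Q : Finset V) : ℕ := #{j | P ⊆ S j ∧ Q ⊆ (S j)ᶜ}

/-- The number of triples of the family that contain `P`. -/
def tripleDegree (S : ι → Finset V) (P : Finset V) : ℕ := #{j | #(S j) = 3 ∧ P ⊆ S j}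

/-- `P` and `Q` are disjoint, each triple of the family through `P` avoids `Q`, and each complement
of a triple of the family that avoids `Q` contains `P`. -/
def Separated (S : ι → Finset V) (P Q : Finset V) : Prop :=
  Disjoint P Q ∧ (∀ j, #(S j) = 3 → P ⊆ S j → Q ⊆ (S j)ᶜ) ∧
    ∀ j, #(S j)ᶜ = 3 → Q ⊆ (S j)ᶜ → P ⊆ S j

theorem splitCount_compl (S : ι → Finset V) (P Q : Finset V) :
    splitCount (fun j => (S j)ᶜ) Q P = splitCount S P Q := by
  simp [splitCount, and_comm]

omit [Fintype ι] in
theorem separated_compl (S : ι → Finset V) (P Q : Finset V) :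
    Separated (fun j => (S j)ᶜ) Q P ↔ Separated S P Q := by
  simp only [Separated, compl_compl, disjoint_comm (a := Q)]
  tauto

/-- The union of `q` triples through `P` has at most `q + 2` points, so some pair `Q` avoids it, and
all `q` triples would split `P` from `Q`. -/
theorem tripleDegree_lt {S : ι → Finset V} {q : ℕ} (hV : q + 4 ≤ Fintype.card V)
    (hS : ∀ P Q, #P = 2 → #Q = 2 → Disjoint P Q → splitCount S P Q < q) {P : Finset V}
    (hP : #P = 2) : tripleDegree S P < q := by
  by_contra! h
  obtain ⟨J, hJ, hJq⟩ := exists_subset_card_eq h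
  have hJ' : ∀ j ∈ J, #(S j) = 3 ∧ P ⊆ S j := fun j hj => by simpa using hJ hj
  have h1 : #(P ∪ J.biUnion fun j => S j \ P) ≤ q + 2 := by
    refine (card_union_le _ _).trans ?_
    have : #(J.biUnion fun j => S j \ P) ≤ #J * 1 := card_biUnion_le_card_mul _ _ 1 fun j hj => by
      rw [card_sdiff_of_subset (hJ' j hj).2, (hJ' j hj).1, hP]
    omega
  have h2 : 2 ≤ #(P ∪ J.biUnion fun j => S j \ P)ᶜ := by
    rw [card_compl]; omega
  obtain ⟨Q, hQ, hQ2⟩ := exists_subset_card_eq h2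
  rw [subset_compl_iff_disjoint_left, disjoint_union_left] at hQ
  refine absurd (hS P Q hP hQ2 hQ.1) (not_lt.2 ?_)
  rw [← hJq]
  refine card_le_card fun j hj => ?_
  simp only [mem_filter, mem_univ, true_and]
  refine ⟨(hJ' j hj).2, ?_⟩
  rw [subset_compl_iff_disjoint_left]
  have h3 : Disjoint (S j \ P) Q := (disjoint_biUnion_left _ _ _).1 hQ.2 j hj
  exact (disjoint_union_left.2 ⟨hQ.1, h3⟩).mono_left (by
    intro x hx; by_cases hxP : x ∈ P <;> simp [hx, hxP])

/-- A pair `Q` not separated from `P` meets `P` (`X₁`), or meets a triple through `P` (`X₂`), or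
lies with some `p ∈ P` in a triple whose complement is in the family (`X₃`). As degrees are below
`q`, these number at most `2 * m`, `3 * q * m` and `6 * q * m`. -/
theorem card_not_separated_le {S : ι → Finset V} {q : ℕ} (hq : 1 ≤ q)
    (hV : q + 4 ≤ Fintype.card V)
    (hS : ∀ P Q, #P = 2 → #Q = 2 → Disjoint P Q → splitCount S P Q < q) (P : Pair V)
    [∀ Q : Pair V, Decidable (Separated S P.1 Q.1)] :
    #{Q : Pair V | ¬ Separated S P.1 Q.1} ≤ 11 * q * Fintype.card V := by
  classical
  set m := Fintype.card V with hm
  have hSc : ∀ P Q, #P = 2 → #Q = 2 → Disjoint P Q → splitCount (fun j => (S j)ᶜ) P Q < q := by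
    intro P Q hP hQ hPQ
    rw [← splitCount_compl]
    simpa using hS Q P hQ hP hPQ.symm
  let star : V → Finset (Finset V) := fun c => univ.image fun x => {c, x}
  have star_card : ∀ c, #(star c) ≤ m := fun c => card_image_le.trans (by simp [hm])
  have mem_star : ∀ (Q : Finset V) (c : V), #Q = 2 → c ∈ Q → Q ∈ star c := by
    intro Q c hQ hc
    obtain ⟨x, y, -, rfl⟩ := card_eq_two.1 hQ
    simp only [mem_insert, mem_singleton] at hc
    rcases hc with rfl | rfl
    · exact mem_image.2 ⟨y, mem_univ _, rfl⟩
    · exact mem_image.2 ⟨x, mem_univ _, pair_comm _ _⟩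
  let X₁ : Finset (Finset V) := P.1.biUnion star
  let X₂ : Finset (Finset V) :=
    ({j | #(S j) = 3 ∧ P.1 ⊆ S j} : Finset ι).biUnion fun j => (S j).biUnion star
  let X₃ : Finset (Finset V) := P.1.biUnion fun p => (univ.erase p).biUnion fun x =>
    ({j | #(S j)ᶜ = 3 ∧ {p, x} ⊆ (S j)ᶜ} : Finset ι).biUnion fun j => powersetCard 2 (S j)ᶜ
  have h1 : #X₁ ≤ 2 * m := by
    rw [← P.2]; exact card_biUnion_le_card_mul _ _ _ fun c _ => star_card c
  have h2 : #X₂ ≤ q * (3 * m) := by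
    refine (card_biUnion_le_card_mul _ _ (3 * m) fun j hj => ?_).trans
      (Nat.mul_le_mul_right _ (tripleDegree_lt hV hS P.2).le)
    rw [← (mem_filter.1 hj).2.1]
    exact card_biUnion_le_card_mul _ _ _ fun c _ => star_card c
  have h3 : #X₃ ≤ 2 * (m * (q * 3)) := by
    rw [← P.2]
    refine card_biUnion_le_card_mul _ _ _ fun p _ => ?_
    refine (card_biUnion_le_card_mul _ _ (q * 3) fun x hx => ?_).trans
      (Nat.mul_le_mul_right _ (card_le_univ _))
    refine (card_biUnion_le_card_mul _ _ 3 fun j hj => ?_).trans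
      (Nat.mul_le_mul_right _ (tripleDegree_lt (S := fun j => (S j)ᶜ) hV hSc (P := {p, x})
        (card_pair (ne_of_mem_erase hx).symm)).le)
    rw [card_powersetCard, (mem_filter.1 hj).2.1]
    decide
  have h4 : #({Q : Pair V | ¬ Separated S P.1 Q.1} : Finset (Pair V)) ≤ #(X₁ ∪ (X₂ ∪ X₃)) := by
    refine card_le_card_of_injOn Subtype.val ?_ Subtype.val_injective.injOn
    intro Q hQ
    simp only [coe_filter, mem_univ, true_and, Set.mem_ofPred_eq] at hQ
    rw [mem_coe, mem_union, mem_union]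
    by_contra! hX
    obtain ⟨hX1, hX2, hX3⟩ := hX
    have hd : Disjoint P.1 Q.1 := by
      rw [disjoint_left]
      intro c hP hQ
      exact hX1 (mem_biUnion.2 ⟨c, hP, mem_star _ _ Q.2 hQ⟩)
    refine hQ ⟨hd, ?_, ?_⟩
    · intro j hj hPj c hc
      rw [mem_compl]
      intro hcj
      exact hX2 (mem_biUnion.2 ⟨j, by simp [hj, hPj], mem_biUnion.2 ⟨c, hcj, mem_star _ _ Q.2 hc⟩⟩)
    · intro j hj hQj p hp
      by_contra hpj
      obtain ⟨x, hx⟩ := card_pos.1 (show 0 < #Q.1 by rw [Q.2]; decide)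
      refine hX3 (mem_biUnion.2 ⟨p, hp, mem_biUnion.2 ⟨x, ?_, mem_biUnion.2 ⟨j, ?_, ?_⟩⟩⟩)
      · refine mem_erase.2 ⟨?_, mem_univ _⟩
        rintro rfl
        exact disjoint_left.1 hd hp hx
      · simp only [mem_filter, mem_univ, true_and]
        refine ⟨hj, ?_⟩
        intro y hy
        simp only [mem_insert, mem_singleton] at hy
        rcases hy with rfl | rfl
        · simpa using hpj
        · exact hQj hx
      · exact mem_powersetCard.2 ⟨hQj, Q.2⟩
  have h5 := card_union_le X₁ (X₂ ∪ X₃)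
  have h6 := card_union_le X₂ X₃
  have h7 : m ≤ q * m := Nat.le_mul_of_pos_left _ hq
  nlinarith

end Columns

/-! ### Shortfall of the extreme columns -/

/-- The number of thirds by which a column of sum `s` exceeds its share of the pairs of pairs. -/
def defect (m s : ℕ) : ℕ :=
  if s ∈ ({0, 1, m - 1, m} : Finset ℕ) then 3 else if s ∈ ({2, m - 2} : Finset ℕ) then 2 else 0

theorem defect_pos_iff {m s : ℕ} : 0 < defect m s ↔ s ∈ extremeSums m := by
  unfold defect extremeSums
  simp only [mem_insert, mem_singleton]
  split_ifs <;> grind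

theorem sum_defect {V : Type*} [Fintype V] [DecidableEq V] (hV : 6 ≤ Fintype.card V) :
    ∑ U : Finset V, defect (Fintype.card V) #U =
      6 * (Fintype.card V + 1) + 4 * (Fintype.card V).choose 2 := by
  set m := Fintype.card V with hm
  rw [← powerset_univ, sum_powerset_apply_card, card_univ, ← hm]
  have hsub : ({0, 1, 2, m - 2, m - 1, m} : Finset ℕ) ⊆ range (m + 1) := by
    intro s hs
    simp only [mem_insert, mem_singleton] at hs
    rw [mem_range]
    omega
  rw [← sum_subset hsub]
  · have c1 : m.choose (m - 1) = m := by
      rw [Nat.choose_symm (by omega), Nat.choose_one_right]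
    have c2 : m.choose (m - 2) = m.choose 2 := Nat.choose_symm (by omega)
    have d0 : defect m 0 = 3 := by simp [defect]
    have d1 : defect m 1 = 3 := by simp [defect]
    have d3 : defect m m = 3 := by simp [defect]
    have d4 : defect m (m - 1) = 3 := by simp [defect]
    have d2 : defect m 2 = 2 := by
      rw [defect, if_neg, if_pos]
      · simp
      · simp only [mem_insert, mem_singleton]; omega
    have d5 : defect m (m - 2) = 2 := by
      rw [defect, if_neg, if_pos]
      · simp
      · simp only [mem_insert, mem_singleton]; omega
    rw [sum_insert, sum_insert, sum_insert, sum_insert, sum_insert, sum_singleton, d0, d1, d2, d3,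
      d4, d5, c1, c2]
    · simp; ring
    all_goals simp only [mem_insert, mem_singleton]; omega
  · intro s _ hs
    have : ¬ 0 < defect m s := by rwa [defect_pos_iff]
    simp [Nat.eq_zero_of_not_pos this]

/-! ### The weighted count of columns -/

section Bound

variable {V : Type*} [Fintype V] [DecidableEq V] {ι : Type*} [Fintype ι]

theorem sum_cover (S : ι → Finset V) (w : Pair V → Pair V → ℕ) :
    ∑ j, cover w (S j) = ∑ P : Pair V, ∑ Q : Pair V, w P Q * splitCount S P.1 Q.1 := by
  unfold cover
  rw [sum_comm]
  refine sum_congr rfl fun P _ => ?_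
  rw [sum_comm]
  refine sum_congr rfl fun Q _ => ?_
  rw [splitCount, ← sum_filter, sum_const, smul_eq_mul, mul_comm]

-- Separation is symmetric under complementing the family and exchanging `P` and `Q`, so the bound
-- on non-separated pairs holds for rows and columns alike. It remains to check that there are
-- enough such pairs for `exists_weight`.
open Classical in
theorem exists_separated_weight {S : ι → Finset V} {q : ℕ} (hq : 1 ≤ q)
    (hV : 1000 * q ^ 2 < Fintype.card V)
    (hS : ∀ P Q, #P = 2 → #Q = 2 → Disjoint P Q → splitCount S P Q < q) :
    ∃ w : Pair V → Pair V → ℕ, (∀ P Q : Pair V, ¬ Separated S P.1 Q.1 → w P Q = 0) ∧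
      (∀ P Q : Pair V, Separated S P.1 Q.1 → 1 ≤ w P Q) ∧
      (∀ P, ∑ Q, w P Q = (Fintype.card V).choose 2) ∧
      (∀ Q, ∑ P, w P Q = (Fintype.card V).choose 2) ∧
      (∀ P : Pair V, #{Q : Pair V | ¬ Separated S P.1 Q.1} ≤ 11 * q * Fintype.card V) ∧
      ∀ Q : Pair V, #{P : Pair V | ¬ Separated S P.1 Q.1} ≤ 11 * q * Fintype.card V := by
  have hV' : q + 4 ≤ Fintype.card V := by nlinarith
  have hSc : ∀ P Q, #P = 2 → #Q = 2 → Disjoint P Q → splitCount (fun j => (S j)ᶜ) P Q < q := by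
    intro P Q hP hQ hPQ
    rw [← splitCount_compl]
    simpa using hS Q P hQ hP hPQ.symm
  have hrow : ∀ P : Pair V, #{Q : Pair V | ¬ Separated S P.1 Q.1} ≤ 11 * q * Fintype.card V :=
    fun P => card_not_separated_le hq hV' hS P
  have hcol : ∀ Q : Pair V, #{P : Pair V | ¬ Separated S P.1 Q.1} ≤ 11 * q * Fintype.card V := by
    intro Q
    have := card_not_separated_le hq hV' hSc Q
    simpa only [separated_compl] using this
  have hE : 2 * ((11 * q * Fintype.card V) * (11 * q * Fintype.card V)) ≤
      #{e : Pair V × Pair V | ¬ Separated S e.1.1 e.2.1} := by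
    -- The `m - 1` pairs through one point of `P` meet `P`. In all this gives about `m ^ 3 / 2`
    -- non-separated positions, against the required `242 * q ^ 2 * m ^ 2`; hence the cubic order
    -- wins once `m > 1000 * q ^ 2`.
    have h1 : ∀ P : Pair V, (Fintype.card V - 1) ≤ #{Q : Pair V | ¬ Separated S P.1 Q.1} := by
      intro P
      obtain ⟨p, hp⟩ := card_pos.1 (show 0 < #P.1 by rw [P.2]; decide)
      rw [← card_univ, ← card_erase_of_mem (mem_univ p)]
      refine card_le_card_of_injOn
        (fun x => if h : p ≠ x then ⟨{p, x}, card_pair h⟩ else P) ?_ ?_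
      · intro x hx
        have hx' : p ≠ x := (ne_of_mem_erase hx).symm
        simp only [hx', dif_pos, ne_eq, not_false_eq_true, coe_filter, mem_univ, true_and,
          Set.mem_ofPred_eq]
        intro h
        exact disjoint_left.1 h.1 hp (by simp)
      · intro x hx y hy hxy
        have hx' : p ≠ x := (ne_of_mem_erase hx).symm
        have hy' : p ≠ y := (ne_of_mem_erase hy).symm
        simp only [hx', hy', dif_pos, ne_eq, not_false_eq_true, Subtype.mk.injEq] at hxy
        have : x ∈ ({p, y} : Finset V) := hxy ▸ by simp
        simp only [mem_insert, mem_singleton] at this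
        exact this.resolve_left hx'.symm
    have h2 : #{e : Pair V × Pair V | ¬ Separated S e.1.1 e.2.1} =
        ∑ P : Pair V, #{Q : Pair V | ¬ Separated S P.1 Q.1} := by
      simp only [card_filter, Fintype.sum_prod_type]
    rw [h2]
    have h3 : ∑ P : Pair V, (Fintype.card V - 1) ≤
        ∑ P : Pair V, #{Q : Pair V | ¬ Separated S P.1 Q.1} := sum_le_sum fun P _ => h1 P
    refine le_trans ?_ h3
    rw [sum_const, card_univ, card_pairs, smul_eq_mul]
    obtain ⟨d, hd⟩ := Nat.exists_eq_add_of_le (show 1 ≤ Fintype.card V by omega)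
    have h4 : (Fintype.card V).choose 2 * 2 = (1 + d) * d := by
      rw [hd, Nat.choose_two_right, Nat.add_sub_cancel_left]
      exact Nat.div_mul_cancel (by
        rw [mul_comm, add_comm]; exact (Nat.even_mul_succ_self d).two_dvd)
    have h5 : Fintype.card V - 1 = d := by omega
    rw [h5]
    rw [hd] at h4 hV ⊢
    have h6 : 484 * q ^ 2 * (1 + d) ≤ d * d := by nlinarith
    nlinarith
  obtain ⟨w, h0, h1, hr, hc⟩ := exists_weight (fun P Q : Pair V => Separated S P.1 Q.1)
    (11 * q * Fintype.card V) hrow hcol hE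
  rw [card_pairs] at hr hc
  exact ⟨w, h0, h1, hr, hc, hrow, hcol⟩

-- Small sets are evaluated exactly: for a 2-set disjointness from `P` already puts `Q` outside, for
-- a triple the second clause of `Separated` does. Sets of at least four points go through
-- `three_mul_lt_choose_mul`. Only sets of at most half the points are treated, since
-- complementation handles the rest.
omit [Fintype ι] in
open Classical in
theorem three_mul_le_cover {S : ι → Finset V} {q : ℕ} (hq : 1 ≤ q)
    (hV : 1000 * q ^ 2 < Fintype.card V) {w : Pair V → Pair V → ℕ}
    (h0 : ∀ P Q : Pair V, ¬ Separated S P.1 Q.1 → w P Q = 0)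
    (h1 : ∀ P Q : Pair V, Separated S P.1 Q.1 → 1 ≤ w P Q)
    (hr : ∀ P, ∑ Q, w P Q = (Fintype.card V).choose 2)
    (hrow : ∀ P : Pair V, #{Q : Pair V | ¬ Separated S P.1 Q.1} ≤ 11 * q * Fintype.card V) (j : ι)
    (hj : 2 * #(S j) ≤ Fintype.card V) :
    3 * (Fintype.card V).choose 2 ≤
        cover w (S j) + (Fintype.card V).choose 2 * defect (Fintype.card V) #(S j) ∧
      (#(S j) ∉ extremeSums (Fintype.card V) ∪ {3, Fintype.card V - 3} →
        3 * (Fintype.card V).choose 2 < cover w (S j)) := by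
  set m := Fintype.card V with hm
  have hm6 : 1000 ≤ m := by nlinarith
  rcases lt_or_ge #(S j) 4 with h | h
  · refine ⟨?_, fun hn => ?_⟩
    · have hcases : #(S j) = 0 ∨ #(S j) = 1 ∨ #(S j) = 2 ∨ #(S j) = 3 := by omega
      rcases hcases with h | h | h | h
      · simp [h, defect]; omega
      · simp [h, defect]; omega
      · have hd : 2 ≤ defect m #(S j) := by
          rw [h, defect]; split_ifs <;> simp_all
        have hc := cover_eq (U := S j) h0 hr (fun P Q hP hg => by
          have : P.1 = S j := eq_of_subset_of_card_le hP (by rw [P.2, h])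
          rw [← this, subset_compl_iff_disjoint_left]
          exact hg.1)
        rw [h] at hc
        rw [hc]
        simp only [Nat.choose_self]
        nlinarith
      · have hc := cover_eq (U := S j) h0 hr (fun P Q hP hg => hg.2.1 j h hP)
        rw [h] at hc
        rw [hc]
        have : (3 : ℕ).choose 2 = 3 := rfl
        rw [this]
        omega
    · refine absurd ?_ hn
      simp only [extremeSums, mem_union, mem_insert, mem_singleton]
      omega
  · have h2 := three_mul_lt_choose_mul hq hV h hj
    have h3 := le_cover (w := w) h1 hrow (S j)
    rw [← hm] at h3
    exact ⟨by omega, fun _ => by omega⟩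

open Classical in
/-- The count of columns in a family without `q` columns splitting the same two pairs, together
with the structure of the families attaining the bound. -/
theorem card_bound {S : ι → Finset V} {q : ℕ} (hq : 2 < q)
    (hV : 1000 * q ^ 2 < Fintype.card V)
    (hinj : ∀ j k, #(S j) ∈ extremeSums (Fintype.card V) → S j = S k → j = k)
    (hS : ∀ P Q, #P = 2 → #Q = 2 → Disjoint P Q → splitCount S P Q < q) :
    3 * Fintype.card ι ≤ (q + 3) * (Fintype.card V).choose 2 + 6 * (Fintype.card V + 1) ∧
    (3 * Fintype.card ι = (q + 3) * (Fintype.card V).choose 2 + 6 * (Fintype.card V + 1) →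
      (∀ U, #U ∈ extremeSums (Fintype.card V) → ∃ j, S j = U) ∧
      (∀ j, #(S j) ∈ extremeSums (Fintype.card V) ∪ {3, Fintype.card V - 3}) ∧
      ∀ P Q, #P = 2 → #Q = 2 → Separated S P Q → splitCount S P Q + 1 = q) := by
  set m := Fintype.card V with hm
  have hm6 : 1000 ≤ m := by nlinarith
  obtain ⟨w, h0, h1, hr, hc, hrow, hcol⟩ := exists_separated_weight (by omega) hV hS
  rw [← hm] at hr hc hrow hcol
  set N := m.choose 2 with hN
  have hNpos : 0 < N := Nat.choose_pos (by omega)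
  have hdef : ∀ s ≤ m, defect m (m - s) = defect m s := by
    intro s hs
    simp only [defect, mem_insert, mem_singleton]
    congr 1
    · rw [eq_iff_iff]; omega
    · congr 1
      rw [eq_iff_iff]; omega
  have hcov : ∀ j, 3 * N ≤ cover w (S j) + N * defect m #(S j) ∧
      (#(S j) ∉ extremeSums m ∪ {3, m - 3} → 3 * N < cover w (S j)) := by
    intro j
    have hjm : #(S j) ≤ m := card_le_univ _
    rcases le_total (2 * #(S j)) m with h | h
    · exact three_mul_le_cover (by omega) hV h0 h1 hr hrow j h
    -- Large sets: the same lemma for the complementary family and the transposed weight, whose row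
    -- sums are the column sums of `w`.
    · have key := three_mul_le_cover (S := fun j => (S j)ᶜ) (w := fun P Q => w Q P)
        (q := q) (by omega) hV
        (fun P Q hPQ => h0 Q P (by rwa [separated_compl] at hPQ))
        (fun P Q hPQ => h1 Q P (by rwa [separated_compl] at hPQ)) hc
        (fun P => by simpa only [separated_compl] using hcol P) j
        (by rw [card_compl]; omega)
      simp only [cover_compl, card_compl, ← hm, hdef _ hjm] at key
      refine ⟨key.1, fun hn => key.2 fun hn' => hn ?_⟩
      simp only [extremeSums, mem_union, mem_insert, mem_singleton] at hn' ⊢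
      omega
  have hsplit : ∀ P Q : Pair V, w P Q * splitCount S P.1 Q.1 ≤ w P Q * (q - 1) := by
    intro P Q
    by_cases hg : Separated S P.1 Q.1
    · exact Nat.mul_le_mul_left _ (Nat.le_sub_one_of_lt (hS _ _ P.2 Q.2 hg.1))
    · simp [h0 P Q hg]
  have hwsum : ∑ P : Pair V, ∑ Q : Pair V, w P Q * (q - 1) = (q - 1) * N * N := by
    simp only [← sum_mul, hr, sum_const, card_univ, card_pairs, ← hm, ← hN, smul_eq_mul]
    ring
  have hsum : ∑ j, cover w (S j) ≤ (q - 1) * N * N := by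
    rw [sum_cover, ← hwsum]
    exact sum_le_sum fun P _ => sum_le_sum fun Q _ => hsplit P Q
  let X : Finset ι := {j | #(S j) ∈ extremeSums m}
  have hdX : ∑ j, defect m #(S j) = ∑ U ∈ X.image S, defect m #U := by
    rw [sum_image]
    · symm
      refine sum_subset (subset_univ _) fun j _ hj => ?_
      have : ¬ 0 < defect m #(S j) := by rw [defect_pos_iff]; simpa [X] using hj
      omega
    · intro j hj k _ hjk
      exact hinj j k (by simpa [X] using hj) hjk
  have hdle : ∑ j, defect m #(S j) ≤ 6 * (m + 1) + 4 * N := by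
    rw [hdX, hm, hN, ← sum_defect (by omega)]
    exact sum_le_sum_of_subset (subset_univ _)
  have htot : ∑ _j : ι, 3 * N ≤ ∑ j, (cover w (S j) + N * defect m #(S j)) :=
    sum_le_sum fun j _ => (hcov j).1
  have htot' := htot
  rw [sum_add_distrib, ← mul_sum univ (fun j => defect m #(S j)), sum_const, card_univ,
    smul_eq_mul] at htot'
  obtain ⟨p, rfl⟩ := Nat.exists_eq_add_of_lt hq
  have hp : 2 + p + 1 - 1 = p + 2 := by omega
  rw [hp] at hsum hwsum hsplit
  have hdN : N * ∑ j, defect m #(S j) ≤ N * (6 * (m + 1) + 4 * N) := Nat.mul_le_mul_left _ hdle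
  refine ⟨?_, fun heq => ?_⟩
  · refine Nat.le_of_mul_le_mul_left (c := N) ?_ hNpos
    nlinarith
  -- Equality in the bound makes each inequality of the chain tight: the total cover, the total
  -- defect, and the estimate for each single column.
  have e0 : N * (3 * Fintype.card ι) = (p + 2) * N * N + N * (6 * (m + 1) + 4 * N) := by
    rw [heq]; ring
  have e1 : ∑ j, cover w (S j) = (p + 2) * N * N := by nlinarith
  have e2 : N * ∑ j, defect m #(S j) = N * (6 * (m + 1) + 4 * N) := by nlinarith
  have e2' : ∑ j, defect m #(S j) = 6 * (m + 1) + 4 * N := Nat.eq_of_mul_eq_mul_left hNpos e2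
  have e3 : ∑ _j : ι, 3 * N = ∑ j, (cover w (S j) + N * defect m #(S j)) := by
    rw [sum_add_distrib, ← mul_sum univ (fun j => defect m #(S j)), sum_const, card_univ,
      smul_eq_mul]
    nlinarith
  refine ⟨?_, ?_, ?_⟩
  · intro U hU
    by_contra! hne
    -- A missing extreme set would lose its positive share of the total defect.
    have hlt : ∑ U ∈ X.image S, defect m #U < ∑ U : Finset V, defect m #U := by
      refine sum_lt_sum_of_subset (subset_univ _) (mem_univ U) ?_ (defect_pos_iff.2 hU)
        fun _ _ _ => Nat.zero_le _
      intro hmem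
      obtain ⟨j, -, hj⟩ := mem_image.1 hmem
      exact hne j hj
    rw [← hdX, e2', hm, sum_defect (by omega), ← hm] at hlt
    omega
  · intro j
    by_contra hn
    have h2 := (sum_eq_sum_iff_of_le fun j _ => (hcov j).1).1 e3 j (mem_univ j)
    have h3 := (hcov j).2 hn
    omega
  · intro P Q hP hQ hg
    -- Tightness passes to each term, and the weight, being positive at a separated pair, can be
    -- cancelled.
    have e4 : ∑ P : Pair V, ∑ Q : Pair V, w P Q * splitCount S P.1 Q.1 =
        ∑ P : Pair V, ∑ Q : Pair V, w P Q * (p + 2) := by rw [← sum_cover, e1, hwsum]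
    have e5 := (sum_eq_sum_iff_of_le fun P _ => sum_le_sum fun Q _ => hsplit P Q).1 e4
      ⟨P, hP⟩ (mem_univ _)
    have e6 := (sum_eq_sum_iff_of_le fun Q _ => hsplit ⟨P, hP⟩ Q).1 e5 ⟨Q, hQ⟩ (mem_univ _)
    have e7 := Nat.eq_of_mul_eq_mul_left (h1 ⟨P, hP⟩ ⟨Q, hQ⟩ hg) e6
    simp only at e7
    omega

end Bound

/-! ### Structure of extremal families -/

section Extremal

variable {V : Type*} [Fintype V] [DecidableEq V] {ι : Type*} [Fintype ι]

/-- With the permitted sizes, a column splitting `P` from `Q` is `P` itself, the complement of `Q`,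
a triple through `P`, or the complement of a triple through `Q`. Conversely, separation makes all of
these split the two pairs. -/
theorem splitCount_eq {S : ι → Finset V} (hV : 6 < Fintype.card V)
    (hinj : ∀ j k, #(S j) ∈ extremeSums (Fintype.card V) → S j = S k → j = k)
    (hall : ∀ U, #U ∈ extremeSums (Fintype.card V) → ∃ j, S j = U)
    (hcard : ∀ j, #(S j) ∈ extremeSums (Fintype.card V) ∪ {3, Fintype.card V - 3})
    {P Q : Finset V} (hP : #P = 2) (hQ : #Q = 2) (hPQ : Separated S P Q) :
    splitCount S P Q = 2 + tripleDegree S P + tripleDegree (fun j => (S j)ᶜ) Q := by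
  have unique : ∀ U, #U ∈ extremeSums (Fintype.card V) → #{j | S j = U} = 1 := by
    intro U hU
    obtain ⟨j, rfl⟩ := hall U hU
    rw [card_eq_one]
    refine ⟨j, ?_⟩
    ext k
    simp only [mem_filter, mem_univ, true_and, mem_singleton]
    exact ⟨fun h => (hinj j k hU h.symm).symm, fun h => by rw [h]⟩
  have hQc : #Qᶜ = Fintype.card V - 2 := by rw [card_compl, hQ]
  rw [show 2 = #{j | S j = P} + #{j | S j = Qᶜ} by
    rw [unique P (by simp [extremeSums, hP]), unique Qᶜ (by simp [extremeSums, hQc])]]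
  unfold splitCount tripleDegree
  simp only [card_filter, ← sum_add_distrib]
  refine sum_congr rfl fun j _ => ?_
  have hj := hcard j
  have hc : #(S j)ᶜ = Fintype.card V - #(S j) := card_compl _
  have hjm : #(S j) ≤ Fintype.card V := card_le_univ _
  have hPQ' : P ⊆ Qᶜ := subset_compl_iff_disjoint_right.2 hPQ.1
  have hQP' : Q ⊆ Pᶜ := subset_compl_iff_disjoint_left.2 hPQ.1
  by_cases hsplit : P ⊆ S j ∧ Q ⊆ (S j)ᶜ
  · rw [if_pos hsplit]
    have h1 := card_le_card hsplit.1
    have h2 := card_le_card hsplit.2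
    simp only [extremeSums, mem_union, mem_insert, mem_singleton] at hj
    have hcases : #(S j) = 2 ∨ #(S j) = Fintype.card V - 2 ∨ #(S j) = 3 ∨
        #(S j) = Fintype.card V - 3 := by omega
    have eP : S j = P ↔ #(S j) = 2 :=
      ⟨fun h => by rw [h, hP], fun h => (eq_of_subset_of_card_le hsplit.1 (by omega)).symm⟩
    have eQ : S j = Qᶜ ↔ #(S j) = Fintype.card V - 2 :=
      ⟨fun h => by rw [h, hQc], fun h => eq_of_subset_of_card_le
        (subset_compl_comm.1 hsplit.2) (by omega)⟩
    simp only [eP, eQ, hsplit.1, hsplit.2, and_true, hc]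
    split_ifs <;> omega
  · rw [if_neg hsplit]
    have n1 : S j ≠ P := fun h => hsplit ⟨h.ge, h ▸ hQP'⟩
    have n2 : S j ≠ Qᶜ := fun h => hsplit ⟨h ▸ hPQ', by rw [h, compl_compl]⟩
    have n3 : ¬ (#(S j) = 3 ∧ P ⊆ S j) := fun h => hsplit ⟨h.2, hPQ.2.1 j h.1 h.2⟩
    have n4 : ¬ (#(S j)ᶜ = 3 ∧ Q ⊆ (S j)ᶜ) := fun h => hsplit ⟨hPQ.2.2 j h.1 h.2, h.2⟩
    rw [if_neg n1, if_neg n2, if_neg n3, if_neg n4]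

-- Each of `P`, `P'` excludes at most `11 * q * m` pairs `Q`, and together these cannot exhaust
-- `m.choose 2` pairs.
open Classical in
theorem exists_separated {S : ι → Finset V} {q : ℕ} (hq : 1 ≤ q)
    (hV : 1000 * q ^ 2 < Fintype.card V)
    (hS : ∀ P Q, #P = 2 → #Q = 2 → Disjoint P Q → splitCount S P Q < q) {P P' : Finset V}
    (hP : #P = 2) (hP' : #P' = 2) :
    ∃ Q, #Q = 2 ∧ Separated S P Q ∧ Separated S P' Q := by
  have hV' : q + 4 ≤ Fintype.card V := by nlinarith
  have h1 := card_not_separated_le hq hV' hS ⟨P, hP⟩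
  have h2 := card_not_separated_le hq hV' hS ⟨P', hP'⟩
  by_contra! hne
  have h3 : (univ : Finset (Pair V)) ⊆ ({Q : Pair V | ¬ Separated S P Q.1} : Finset (Pair V)) ∪
      ({Q : Pair V | ¬ Separated S P' Q.1} : Finset (Pair V)) := by
    intro Q _
    by_cases h : Separated S P Q.1
    · simpa [h] using hne Q.1 Q.2 h
    · simp [h]
  have h4 := (card_le_card h3).trans (card_union_le _ _)
  rw [card_univ, card_pairs] at h4
  set m := Fintype.card V
  have h5 : m.choose 2 * 2 = m * (m - 1) := by
    rw [Nat.choose_two_right]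
    exact Nat.div_mul_cancel (Nat.even_mul_pred_self m).two_dvd
  obtain ⟨d, hd⟩ := Nat.exists_eq_add_of_le (show 1 ≤ m by omega)
  rw [hd, Nat.add_sub_cancel_left] at h5
  rw [hd] at h1 h2 h4 hV
  nlinarith

/-- In an extremal family the triples, and the complements of triples, form designs. -/
theorem exists_tripleDegree_eq {S : ι → Finset V} {q : ℕ} (hq : 2 < q)
    (hV : 1000 * q ^ 2 < Fintype.card V)
    (hinj : ∀ j k, #(S j) ∈ extremeSums (Fintype.card V) → S j = S k → j = k)
    (hS : ∀ P Q, #P = 2 → #Q = 2 → Disjoint P Q → splitCount S P Q < q)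
    (hall : ∀ U, #U ∈ extremeSums (Fintype.card V) → ∃ j, S j = U)
    (hcard : ∀ j, #(S j) ∈ extremeSums (Fintype.card V) ∪ {3, Fintype.card V - 3})
    (htight : ∀ P Q, #P = 2 → #Q = 2 → Separated S P Q → splitCount S P Q + 1 = q) :
    ∃ a b, a + b + 3 = q ∧ (∀ P, #P = 2 → tripleDegree S P = a) ∧
      ∀ P, #P = 2 → tripleDegree (fun j => (S j)ᶜ) P = b := by
  have h6 : 6 < Fintype.card V := by nlinarith
  have hsum : ∀ P Q, #P = 2 → #Q = 2 → Separated S P Q →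
      tripleDegree S P + tripleDegree (fun j => (S j)ᶜ) Q + 3 = q := by
    intro P Q hP hQ hPQ
    have e1 := htight P Q hP hQ hPQ
    rw [splitCount_eq h6 hinj hall hcard hP hQ hPQ] at e1
    omega
  have hSc : ∀ P Q, #P = 2 → #Q = 2 → Disjoint P Q → splitCount (fun j => (S j)ᶜ) P Q < q := by
    intro P Q hP hQ hPQ
    rw [← splitCount_compl]
    simpa using hS Q P hQ hP hPQ.symm
  obtain ⟨P₀, -, hP₀⟩ := exists_subset_card_eq (show 2 ≤ #(univ : Finset V) by
    rw [card_univ]; omega)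
  have hconst : ∀ P, #P = 2 → tripleDegree S P = tripleDegree S P₀ := by
    intro P hP
    obtain ⟨Q, hQ, h1, h2⟩ := exists_separated (by omega) hV hS hP hP₀
    have e1 := hsum P Q hP hQ h1
    have e2 := hsum P₀ Q hP₀ hQ h2
    omega
  have hlt : tripleDegree S P₀ + 3 ≤ q := by
    obtain ⟨Q, hQ, h1, -⟩ := exists_separated (by omega) hV hS hP₀ hP₀
    have := hsum P₀ Q hP₀ hQ h1
    omega
  refine ⟨tripleDegree S P₀, q - 3 - tripleDegree S P₀, by omega, hconst, ?_⟩
  intro Q hQ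
  obtain ⟨P, hP, h1, -⟩ := exists_separated (S := fun j => (S j)ᶜ) (by omega) hV hSc hQ hQ
  rw [separated_compl] at h1
  have := hsum P Q hP hQ h1
  rw [hconst P hP] at this
  omega

end Extremal

/-! ### From set families to matrices -/

section Matrices

variable {m n : ℕ}

theorem mem_support {v : Fin m → Fin 2} {i : Fin m} : i ∈ support v ↔ v i = 1 := by
  simp [support]

theorem colSum_eq_card (v : Fin m → Fin 2) : colSum v = #(support v) := by
  rw [colSum, support, card_filter]
  refine sum_congr rfl fun i _ => ?_
  have : v i = 0 ∨ v i = 1 := by omega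
  rcases this with h | h <;> simp [h]

theorem support_injective : Function.Injective (support (m := m)) := by
  intro v w h
  funext i
  have hi : v i = 1 ↔ w i = 1 := by rw [← mem_support, ← mem_support, h]
  omega

theorem support_indicator (U : Finset (Fin m)) :
    support (fun i => if i ∈ U then (1 : Fin 2) else 0) = U := by
  ext i
  simp [mem_support]

/-- The support of a column of a matrix. -/
abbrev colSet (A : Matrix (Fin m) (Fin n) (Fin 2)) (j : Fin n) : Finset (Fin m) :=
  support fun i => A i j

theorem hasConfiguration_copies {A : Matrix (Fin m) (Fin n) (Fin 2)} {q : ℕ} :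
    HasConfiguration A (copies q 2 2) ↔
      ∃ P Q, #P = 2 ∧ #Q = 2 ∧ Disjoint P Q ∧ q ≤ splitCount (colSet A) P Q := by
  constructor
  · rintro ⟨r, c, h⟩
    have h' : ∀ i j, A (r i) (c j) = if (i : ℕ) < 2 then 1 else 0 := fun i j =>
      congrFun (congrFun h i) j
    have hr : ∀ i j : Fin 4, i ≠ j → r i ≠ r j := fun i j hij => r.injective.ne hij
    refine ⟨{r 0, r 1}, {r 2, r 3}, card_pair (hr _ _ (by decide)),
      card_pair (hr _ _ (by decide)), ?_, ?_⟩
    · simp only [disjoint_insert_left, disjoint_singleton_left, mem_insert, mem_singleton, not_or]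
      exact ⟨⟨hr _ _ (by decide), hr _ _ (by decide)⟩, hr _ _ (by decide), hr _ _ (by decide)⟩
    · have : q = #(univ.map c) := by simp
      rw [this]
      refine card_le_card fun j hj => ?_
      obtain ⟨k, -, rfl⟩ := mem_map.1 hj
      simp only [mem_filter, mem_univ, true_and, insert_subset_iff, singleton_subset_iff,
        mem_compl, mem_support]
      rw [h' 0 k, h' 1 k, h' 2 k, h' 3 k]
      decide
  · rintro ⟨P, Q, hP, hQ, hPQ, hq⟩
    obtain ⟨a, b, hab, rfl⟩ := card_eq_two.1 hP
    obtain ⟨c, d, hcd, rfl⟩ := card_eq_two.1 hQ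
    obtain ⟨J, hJ, hJq⟩ := exists_subset_card_eq hq
    simp only [disjoint_insert_left, disjoint_singleton_left, mem_insert, mem_singleton,
      not_or] at hPQ
    obtain ⟨⟨hac, had⟩, hbc, hbd⟩ := hPQ
    let e : Fin q ↪ Fin n := (J.orderEmbOfFin hJq).toEmbedding
    refine ⟨⟨![a, b, c, d], ?_⟩, e, ?_⟩
    · intro i j hij
      fin_cases i <;> fin_cases j <;> simp_all [eq_comm]
    · refine Matrix.ext fun i j => ?_
      have hj : e j ∈ J := J.orderEmbOfFin_mem hJq j
      have := hJ hj
      simp only [mem_filter, mem_univ, true_and, insert_subset_iff, singleton_subset_iff,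
        mem_compl, mem_support] at this
      obtain ⟨⟨h1, h2⟩, h3, h4⟩ := this
      have z : ∀ x : Fin 2, x ≠ 1 → x = 0 := by decide
      fin_cases i
      · exact h1
      · exact h2
      · exact z _ h3
      · exact z _ h4

theorem countP_columnSets (A : Matrix (Fin m) (Fin n) (Fin 2)) (s : ℕ)
    (p : Finset (Fin m) → Prop) [DecidablePred p] :
    (columnSets A s).countP p = #{j | #(colSet A j) = s ∧ p (colSet A j)} := by
  rw [columnSets, Multiset.countP_map, ← filter_val, filter_filter]
  simp only [colSum_eq_card]
  rfl

/-- A family of triples in which all pairs of points have the same degree is a triple system. -/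
theorem isTripleSystem_of_countP {T : Multiset (Finset (Fin m))} {a : ℕ}
    (h3 : ∀ B ∈ T, #B = 3) (hT : ∀ P, #P = 2 → T.countP (fun B => P ⊆ B) = a) :
    IsTripleSystem a m T where
  card_block := h3
  card_eq := by
    -- Double counting of incidences between pairs and blocks; each triple contains three pairs.
    have h1 : ∑ P ∈ powersetCard 2 (univ : Finset (Fin m)), T.countP (fun B => P ⊆ B) =
        (T.map fun B => (#B).choose 2).sum := by
      clear h3 hT
      induction T using Multiset.induction_on with
      | empty => simp
      | cons B T ih =>
        simp only [Multiset.countP_cons, sum_add_distrib, ih, Multiset.map_cons,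
          Multiset.sum_cons]
        rw [add_comm, ← card_filter, ← card_powersetCard]
        congr 2
        ext P
        simp [mem_powersetCard, and_comm]
    rw [sum_congr rfl fun P hP => hT P (mem_powersetCard.1 hP).2, sum_const, card_powersetCard,
      Multiset.map_congr rfl fun B hB => by rw [h3 B hB]] at h1
    simp at h1
    linarith
  pair_count := by
    intro i j hij
    rw [← hT {i, j} (card_pair hij)]
    simp [insert_subset_iff]

theorem isTripleSystem_columnSets {A : Matrix (Fin m) (Fin n) (Fin 2)} {a : ℕ}
    (h : ∀ P, #P = 2 → tripleDegree (colSet A) P = a) : IsTripleSystem a m (columnSets A 3) := by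
  refine isTripleSystem_of_countP ?_ ?_
  · intro B hB
    simp only [columnSets, Multiset.mem_map, mem_val, mem_filter, mem_univ, true_and,
      colSum_eq_card] at hB
    obtain ⟨j, hj, rfl⟩ := hB
    exact hj
  · intro P hP
    rw [countP_columnSets, ← h P hP, tripleDegree]

theorem isTripleSystem_compl_columnSets {A : Matrix (Fin m) (Fin n) (Fin 2)} {b : ℕ} (hm : 3 ≤ m)
    (h : ∀ P, #P = 2 → tripleDegree (fun j => (colSet A j)ᶜ) P = b) :
    IsTripleSystem b m ((columnSets A (m - 3)).map fun s => sᶜ) := by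
  have hc : ∀ j, #(colSet A j) = m - 3 ↔ #(colSet A j)ᶜ = 3 := by
    intro j
    have := card_le_univ (colSet A j)
    rw [card_compl, Fintype.card_fin] at *
    omega
  refine isTripleSystem_of_countP ?_ ?_
  · intro B hB
    simp only [columnSets, Multiset.mem_map, mem_val, mem_filter, mem_univ, true_and,
      colSum_eq_card] at hB
    obtain ⟨_, ⟨j, hj, rfl⟩, rfl⟩ := hB
    exact (hc j).1 hj
  · intro P hP
    rw [Multiset.countP_map, ← Multiset.countP_eq_card_filter, countP_columnSets, ← h P hP,
      tripleDegree]
    simp only [hc]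

/-- The upper bound on the number of columns, and the structure of extremal matrices. -/
theorem columns_bound {q : ℕ} (hq : 2 < q) (hm : 1000 * q ^ 2 < m)
    {A : Matrix (Fin m) (Fin n) (Fin 2)} (hA : NoRepeatedExtremeColumn A)
    (hF : ¬ HasConfiguration A (copies q 2 2)) :
    3 * n ≤ (q + 3) * m.choose 2 + 6 * (m + 1) ∧
      (3 * n = (q + 3) * m.choose 2 + 6 * (m + 1) → IsDesignMatrix q A) := by
  have hS : ∀ P Q, #P = 2 → #Q = 2 → Disjoint P Q → splitCount (colSet A) P Q < q := by
    intro P Q hP hQ hPQ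
    by_contra! h
    exact hF (hasConfiguration_copies.2 ⟨P, Q, hP, hQ, hPQ, h⟩)
  have hinj : ∀ j k, #(colSet A j) ∈ extremeSums (Fintype.card (Fin m)) →
      colSet A j = colSet A k → j = k := by
    intro j k hj hjk
    rw [← colSum_eq_card, Fintype.card_fin] at hj
    exact hA j k hj fun i => congrFun (support_injective hjk) i
  have hV : 1000 * q ^ 2 < Fintype.card (Fin m) := by rwa [Fintype.card_fin]
  obtain ⟨h1, h2⟩ := card_bound hq hV hinj hS
  simp only [Fintype.card_fin] at h1 h2
  refine ⟨h1, fun heq => ?_⟩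
  obtain ⟨hall, hcard, htight⟩ := h2 heq
  obtain ⟨a, b, hab, ha, hb⟩ := exists_tripleDegree_eq hq hV hinj hS
    (by simpa using hall) (by simpa using hcard) htight
  refine ⟨?_, ⟨a, b, hab, isTripleSystem_columnSets ha,
    isTripleSystem_compl_columnSets (by nlinarith) hb⟩, ?_⟩
  · intro v hv
    rw [colSum_eq_card] at hv
    obtain ⟨j, hj⟩ := hall _ hv
    refine ⟨j, support_injective hj, fun k hk => ?_⟩
    refine hinj k j ?_ ?_
    · rw [Fintype.card_fin]
      change #(support fun i => A i k) ∈ _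
      rwa [hk]
    · exact (congrArg support hk).trans hj.symm
  · intro j
    rw [colSum_eq_card]
    exact hcard j

end Matrices

/-! ### Steiner triple systems as operations -/

/-- The operation sending two points of a Steiner triple system to the third point of their triple. -/
structure IsSteiner {V : Type*} (f : V → V → V) : Prop where
  idem : ∀ x, f x x = x
  comm : ∀ x y, f x y = f y x
  cancel : ∀ x y, f x (f x y) = y

namespace IsSteiner

variable {V W : Type*} {f : V → V → V}

theorem cancel_right (hf : IsSteiner f) (x y : V) : f (f x y) y = x := by
  rw [hf.comm, hf.comm x, hf.cancel]

theorem ne_left (hf : IsSteiner f) {x y : V} (h : x ≠ y) : f x y ≠ x := by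
  intro e
  have := hf.cancel x y
  rw [e, hf.idem] at this
  exact h this

theorem ne_right (hf : IsSteiner f) {x y : V} (h : x ≠ y) : f x y ≠ y := by
  rw [hf.comm]; exact hf.ne_left h.symm

theorem conj (hf : IsSteiner f) (e : V ≃ W) :
    IsSteiner fun x y => e (f (e.symm x) (e.symm y)) where
  idem x := by simp [hf.idem]
  comm x y := by rw [hf.comm]
  cancel x y := by simp [hf.cancel]

/-- Any two points of a triple generate it, so a triple containing `x` and `y` is determined by
them. -/
theorem triple_eq [DecidableEq V] (hf : IsSteiner f) {u v x y : V} (hxy : x ≠ y)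
    (h : {x, y} ⊆ ({u, v, f u v} : Finset V)) :
    ({u, v, f u v} : Finset V) = {x, y, f x y} := by
  have c1 := hf.cancel u v
  have c2 := hf.cancel_right u v
  have c3 := hf.comm u v
  have c4 : f (f u v) u = v := by rw [hf.comm, c1]
  have c5 : f v (f u v) = u := by rw [hf.comm, c2]
  have hx : x ∈ ({u, v, f u v} : Finset V) := h (by simp)
  have hy : y ∈ ({u, v, f u v} : Finset V) := h (by simp)
  simp only [mem_insert, mem_singleton] at hx hy
  rcases hx with rfl | rfl | rfl <;> rcases hy with rfl | rfl | rfl <;>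
    first
    | exact absurd rfl hxy
    | rfl
    | (simp only [c1, c2, c4, c5, ← c3]; ext z; simp only [mem_insert, mem_singleton]; tauto)

end IsSteiner

/-- Pairwise disjoint Steiner triple systems form a simple triple system of higher index. -/
theorem exists_triples {V : Type*} [Fintype V] [DecidableEq V] {a : ℕ} (f : Fin a → V → V → V)
    (hf : ∀ k, IsSteiner (f k)) (hne : ∀ k l x y, x ≠ y → f k x y = f l x y → k = l) :
    ∃ T : Finset (Finset V), (∀ U ∈ T, #U = 3) ∧
      ∀ P, #P = 2 → #{U ∈ T | P ⊆ U} = a := by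
  refine ⟨({p : Fin a × V × V | p.2.1 ≠ p.2.2} : Finset _).image
    fun p => {p.2.1, p.2.2, f p.1 p.2.1 p.2.2}, ?_, ?_⟩
  · intro U hU
    obtain ⟨⟨k, x, y⟩, hp, rfl⟩ := mem_image.1 hU
    have hxy : x ≠ y := by simpa using hp
    rw [card_eq_three]
    exact ⟨x, y, _, hxy, ((hf k).ne_left hxy).symm, ((hf k).ne_right hxy).symm, rfl⟩
  · intro P hP
    obtain ⟨x, y, hxy, rfl⟩ := card_eq_two.1 hP
    have : ({U ∈ ({p : Fin a × V × V | p.2.1 ≠ p.2.2} : Finset _).image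
        (fun p => ({p.2.1, p.2.2, f p.1 p.2.1 p.2.2} : Finset V)) | {x, y} ⊆ U} : Finset _) =
        univ.image fun k => ({x, y, f k x y} : Finset V) := by
      ext U
      simp only [mem_filter, mem_image, mem_univ, true_and]
      constructor
      · rintro ⟨⟨⟨k, u, v⟩, -, rfl⟩, h⟩
        exact ⟨k, ((hf k).triple_eq hxy h).symm⟩
      · rintro ⟨k, rfl⟩
        exact ⟨⟨(k, x, y), hxy, rfl⟩, by simp [insert_subset_iff]⟩
    rw [this, card_image_of_injective, card_univ, Fintype.card_fin]
    intro k l hkl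
    have h1 : f k x y ∈ ({x, y, f l x y} : Finset V) := by
      simp only at hkl
      rw [← hkl]; simp
    simp only [mem_insert, mem_singleton] at h1
    rcases h1 with h | h | h
    · exact absurd h ((hf k).ne_left hxy)
    · exact absurd h ((hf k).ne_right hxy)
    · exact hne k l x y hxy h

/-! ### The Bose and Skolem construction on three levels -/

section Levels

variable {X : Type*} [DecidableEq X]

/-- The third point on a triple through the points `x` of level `i` and `y` of level `i + 1`. -/
def levelUp (d : X → X → X) (L : X → Prop) [DecidablePred L] (x y : X) (i : ZMod 3) :
    Option (X × ZMod 3) :=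
  if d x y = x then if L x then some (x, i + 2) else none else some (d x y, i)

/-- The third point on a triple through the point at infinity and the point `x` of level `i`. -/
def levelTip (σ : X → X) (L : X → Prop) [DecidablePred L] (x : X) (i : ZMod 3) :
    Option (X × ZMod 3) :=
  if L x then some (σ x, i + 2) else some (σ x, i + 1)

/-- The operation of the Bose and Skolem triple systems on three copies of a commutative quasigroup
`s` with division `d` and a point at infinity; `L` is the set of idempotents. -/
def levelOp (s d : X → X → X) (σ : X → X) (L : X → Prop) [DecidablePred L] :
    Option (X × ZMod 3) → Option (X × ZMod 3) → Option (X × ZMod 3)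
  | none, none => none
  | none, some (x, i) => levelTip σ L x i
  | some (x, i), none => levelTip σ L x i
  | some (x, i), some (y, j) =>
    if j = i then if x = y then some (x, i) else some (s x y, i + 1)
    else if j = i + 1 then levelUp d L x y i else levelUp d L y x j

theorem level_cases : ∀ i j : ZMod 3, j = i ∨ j = i + 1 ∨ i = j + 1 := by decide

theorem succ_ne : ∀ i : ZMod 3, i + 1 ≠ i := by decide

theorem ne_succ_succ : ∀ i : ZMod 3, i ≠ i + 1 + 1 := by decide

theorem add_two_succ : ∀ i : ZMod 3, i + 2 + 1 = i := by decide

theorem succ_add_two : ∀ i : ZMod 3, i + 1 + 2 = i := by decide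

theorem add_two_add_two : ∀ i : ZMod 3, i + 2 + 2 = i + 1 := by decide

theorem succ_succ : ∀ i : ZMod 3, i + 1 + 1 = i + 2 := by decide

variable {s d : X → X → X} {σ : X → X} {L : X → Prop} [DecidablePred L]

theorem levelOp_same (x y : X) (i : ZMod 3) : levelOp s d σ L (some (x, i)) (some (y, i)) =
    if x = y then some (x, i) else some (s x y, i + 1) := by
  simp [levelOp]

theorem levelOp_up (x y : X) (i : ZMod 3) :
    levelOp s d σ L (some (x, i)) (some (y, i + 1)) = levelUp d L x y i := by
  simp [levelOp]

theorem levelOp_down (x y : X) (i : ZMod 3) :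
    levelOp s d σ L (some (x, i + 1)) (some (y, i)) = levelUp d L y x i := by
  simp [levelOp, ne_succ_succ]

theorem levelOp_comm (hs : ∀ x y, s x y = s y x) (p q : Option (X × ZMod 3)) :
    levelOp s d σ L p q = levelOp s d σ L q p := by
  rcases p with _ | ⟨x, i⟩ <;> rcases q with _ | ⟨y, j⟩
  · rfl
  · rfl
  · rfl
  · rcases level_cases i j with rfl | rfl | rfl
    · rw [levelOp_same, levelOp_same, hs x y]
      by_cases h : x = y
      · simp [h]
      · simp [h, Ne.symm h]
    · rw [levelOp_up, levelOp_down]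
    · rw [levelOp_up, levelOp_down]

theorem levelOp_idem (p : Option (X × ZMod 3)) : levelOp s d σ L p p = p := by
  rcases p with _ | ⟨x, i⟩
  · rfl
  · simp [levelOp_same]

/-- The point at infinity is entered only from a non-idempotent `x` on level `i` and `σ x = s x x`
on level `i + 1`. With no non-idempotents the hypothesis on `σ` is vacuous, which is the form that
Bose's construction needs. -/
theorem levelOp_cancel_some (hs : ∀ x y, s x y = s y x) (hsd : ∀ x y, s x (d x y) = y)
    (hds : ∀ x y, d x (s x y) = y) (hL : ∀ x, L x → s x x = x)
    (hσ : ∀ x, ¬ L x → s x x = σ x ∧ L (σ x) ∧ σ (σ x) = x) (p q : X × ZMod 3) :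
    levelOp s d σ L (some p) (levelOp s d σ L (some p) (some q)) = some q := by
  obtain ⟨x, i⟩ := p
  obtain ⟨y, j⟩ := q
  rcases level_cases i j with rfl | rfl | rfl
  · by_cases h : x = y
    · subst h; simp [levelOp_same]
    · simp [levelOp_same, h, levelOp_up, levelUp, hds, Ne.symm h]
  · by_cases h : d x y = x
    · have hy : y = s x x := by rw [← hsd x y, h]
      by_cases hx : L x
      · rw [hL x hx] at hy
        subst hy
        have e := levelOp_down (s := s) (d := d) (σ := σ) (L := L) y y (i + 2)
        rw [add_two_succ] at e
        rw [levelOp_up, levelUp, if_pos h, if_pos hx, e, levelUp, if_pos h, if_pos hx,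
          add_two_add_two]
      · rw [levelOp_up, levelUp, if_pos h, if_neg hx]
        simp [levelOp, levelTip, hx, hy, (hσ x hx).1]
    · rw [levelOp_up, levelUp, if_neg h, levelOp_same, if_neg (Ne.symm h), hsd]
  · by_cases h : d y x = y
    · have hx : x = s y y := by rw [← hsd y x, h]
      by_cases hy : L y
      · rw [hL y hy] at hx
        subst hx
        have e := levelOp_up (s := s) (d := d) (σ := σ) (L := L) x x (j + 1)
        rw [succ_succ] at e
        rw [levelOp_down, levelUp, if_pos h, if_pos hy, e, levelUp, if_pos h, if_pos hy,
          succ_add_two]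
      · rw [levelOp_down, levelUp, if_pos h, if_neg hy]
        obtain ⟨h1, h2, h3⟩ := hσ y hy
        rw [h1] at hx
        subst hx
        simp [levelOp, levelTip, h2, h3, succ_add_two]
    · have e : d (d y x) x = y := by
        have h1 := hds (d y x) y
        rwa [hs, hsd] at h1
      rw [levelOp_down, levelUp, if_neg h, levelOp_down, levelUp, e, if_neg (Ne.symm h)]

theorem isSteiner_levelOp (hs : ∀ x y, s x y = s y x) (hsd : ∀ x y, s x (d x y) = y)
    (hds : ∀ x y, d x (s x y) = y) (hL : ∀ x, L x → s x x = x)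
    (hσ : ∀ x, ¬ L x → s x x = σ x ∧ L (σ x)) (hσσ : ∀ x, σ (σ x) = x)
    (hLσ : ∀ x, L x → ¬ L (σ x)) : IsSteiner (levelOp s d σ L) where
  idem := levelOp_idem
  comm := levelOp_comm hs
  cancel := by
    have hdσ : ∀ x, ¬ L x → d x (σ x) = x := fun x hx => by
      have := hds x x
      rwa [(hσ x hx).1] at this
    rintro (_ | ⟨x, i⟩) (_ | ⟨y, j⟩)
    · rfl
    · by_cases h : L y
      · simp [levelOp, levelTip, h, hLσ y h, hσσ, add_two_succ]
      · simp [levelOp, levelTip, h, (hσ y h).2, hσσ, succ_add_two]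
    · change levelOp s d σ L (some (x, i)) (levelTip σ L x i) = none
      by_cases h : L x
      · have e := levelOp_down (s := s) (d := d) (σ := σ) (L := L) x (σ x) (i + 2)
        rw [add_two_succ] at e
        have h2 := hdσ (σ x) (hLσ x h)
        rw [hσσ] at h2
        rw [levelTip, if_pos h, e, levelUp, if_pos h2, if_neg (hLσ x h)]
      · rw [levelTip, if_neg h, levelOp_up, levelUp, if_pos (hdσ x h), if_neg h]
    · exact levelOp_cancel_some hs hsd hds hL
        (fun x hx => ⟨(hσ x hx).1, (hσ x hx).2, hσσ x⟩) _ _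

/-- Translation of level `i` by `a i`. -/
@[simps]
def shift [AddCommGroup X] (a : ZMod 3 → X) : X × ZMod 3 ≃ X × ZMod 3 where
  toFun p := (p.1 + a p.2, p.2)
  invFun p := (p.1 - a p.2, p.2)
  left_inv p := by simp
  right_inv p := by simp

/-- The operation `levelOp` transported along a translation of the levels. -/
def shiftedOp [AddCommGroup X] (s d : X → X → X) (σ : X → X) (L : X → Prop) [DecidablePred L]
    (a : ZMod 3 → X) (p q : Option (X × ZMod 3)) : Option (X × ZMod 3) :=
  (shift a).optionCongr
    (levelOp s d σ L ((shift a).optionCongr.symm p) ((shift a).optionCongr.symm q))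

theorem shiftedOp_eq [AddCommGroup X] (a : ZMod 3 → X) (p q : Option (X × ZMod 3)) :
    shiftedOp s d σ L a p q = (levelOp s d σ L (p.map (shift a).symm)
      (q.map (shift a).symm)).map (shift a) := rfl

/-- Translations with different increments give disjoint triple systems. -/
theorem shiftedOp_ne [AddCommGroup X] (hs : ∀ x y, s x y = s y x)
    (hsd : ∀ x y, s x (d x y) = y) {a b : ZMod 3 → X}
    (hab : ∀ x y i, s (x - a i) (y - a i) + a (i + 1) ≠ s (x - b i) (y - b i) + b (i + 1))
    (hσ : ∀ x i j, σ (x - a i) + a j = σ (x - b i) + b j → i = j)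
    {p q : Option (X × ZMod 3)} (hpq : p ≠ q) :
    shiftedOp s d σ L a p q ≠ shiftedOp s d σ L b p q := by
  have comm : ∀ a p q, shiftedOp s d σ L a p q = shiftedOp s d σ L a q p := fun a p q => by
    rw [shiftedOp, levelOp_comm hs]; rfl
  have up : ∀ x y i, shiftedOp s d σ L a (some (x, i)) (some (y, i + 1)) ≠
      shiftedOp s d σ L b (some (x, i)) (some (y, i + 1)) := by
    intro x y i
    have three : (2 : ZMod 3) ≠ 0 := by decide
    have h1 : ∀ c : ZMod 3 → X, shiftedOp s d σ L c (some (x, i)) (some (y, i + 1)) =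
        (levelUp d L (x - c i) (y - c (i + 1)) i).map (shift c) := by
      intro c
      simp [shiftedOp_eq, levelOp_up]
    have h2 : ∀ c : ZMod 3 → X, y = s (x - c i) (d (x - c i) (y - c (i + 1))) + c (i + 1) := by
      intro c; rw [hsd]; simp
    rw [h1, h1]
    intro e
    by_cases ha : d (x - a i) (y - a (i + 1)) = x - a i <;>
      by_cases hb : d (x - b i) (y - b (i + 1)) = x - b i
    -- Both third points are exceptional (on level `i + 2` or at infinity), so both translates of
    -- the square of `x` equal `y`. This is why `hab` must allow equal arguments.
    · refine hab x x i ?_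
      have ea := h2 a
      have eb := h2 b
      rw [ha] at ea
      rw [hb] at eb
      rw [← ea, ← eb]
    -- One third point is on level `i + 2` or at infinity, the other on level `i`.
    · by_cases hLa : L (x - a i) <;> simp [levelUp, ha, hb, hLa, three] at e
    · by_cases hLb : L (x - b i) <;> simp [levelUp, ha, hb, hLb, three] at e
    · simp only [levelUp, ha, hb, if_false, Option.map_some, shift_apply, Option.some.injEq,
        Prod.mk.injEq, and_true] at e
      refine hab x (d (x - a i) (y - a (i + 1)) + a i) i ?_
      have ea := h2 a
      have eb := h2 b
      rw [add_sub_cancel_right, ← ea, e, add_sub_cancel_right, ← eb]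
  have tip : ∀ x i, shiftedOp s d σ L a none (some (x, i)) ≠
      shiftedOp s d σ L b none (some (x, i)) := by
    intro x i
    have h1 : ∀ c : ZMod 3 → X, shiftedOp s d σ L c none (some (x, i)) =
        (levelTip σ L (x - c i) i).map (shift c) := by
      intro c
      simp [shiftedOp_eq, levelOp]
    have two : (2 : ZMod 3) ≠ 0 := by decide
    have one_two : (1 : ZMod 3) ≠ 2 := by decide
    rw [h1, h1]
    intro e
    by_cases ha : L (x - a i) <;> by_cases hb : L (x - b i) <;>
      simp [levelTip, ha, hb, one_two, one_two.symm] at e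
    · have := hσ x i _ e
      simp [two] at this
    · exact succ_ne i (hσ x i _ e).symm
  rcases p with _ | ⟨x, i⟩ <;> rcases q with _ | ⟨y, j⟩
  · exact absurd rfl hpq
  · exact tip y j
  · rw [comm, comm b]
    exact tip x i
  · rcases level_cases i j with rfl | rfl | rfl
    · have hxy : x ≠ y := by rintro rfl; exact hpq rfl
      have h1 : ∀ c : ZMod 3 → X, shiftedOp s d σ L c (some (x, j)) (some (y, j)) =
          some (s (x - c j) (y - c j) + c (j + 1), j + 1) := by
        intro c
        simp [shiftedOp_eq, levelOp_same, hxy]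
      rw [h1, h1]
      intro e
      exact hab x y j (by simpa using e)
    · exact up x y i
    · rw [comm, comm b]
      exact up y x j

end Levels

/-! ### Bose's systems and their disjoint translates -/

/-- The increments of `k * i` around the three levels are `k`, `k`, `-2 * k`. Comparing `2 * k` with
`2 * l` serves all three cases, and explains the hypotheses `2 * k < N` and `2 * l < N`. -/
theorem increment_injective {N k l : ℕ} (hk : 2 * k < N) (hl : 2 * l < N) (i : ZMod 3)
    (h : ((k * (i + 1).val : ℕ) : ZMod N) - ((k * i.val : ℕ) : ZMod N) =
      ((l * (i + 1).val : ℕ) : ZMod N) - ((l * i.val : ℕ) : ZMod N)) : k = l := by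
  have two : ((2 * k : ℕ) : ZMod N) = ((2 * l : ℕ) : ZMod N) → k = l := by
    intro e
    rw [ZMod.natCast_eq_natCast_iff, Nat.ModEq, Nat.mod_eq_of_lt hk, Nat.mod_eq_of_lt hl] at e
    omega
  have v0 : (0 : ZMod 3).val = 0 := rfl
  have v1 : (1 : ZMod 3).val = 1 := rfl
  have v2 : (2 : ZMod 3).val = 2 := rfl
  have e1 : (0 : ZMod 3) + 1 = 1 := rfl
  have e2 : (1 : ZMod 3) + 1 = 2 := rfl
  have e3 : (2 : ZMod 3) + 1 = 0 := rfl
  have hi : i = 0 ∨ i = 1 ∨ i = 2 := by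
    clear h; revert i; decide
  apply two
  push_cast at h ⊢
  rcases hi with rfl | rfl | rfl
  · simp only [e1, v0, v1] at h
    push_cast at h
    linear_combination 2 * h
  · simp only [e2, v2, v1] at h
    push_cast at h
    linear_combination 2 * h
  · simp only [e3, v0, v2] at h
    push_cast at h
    linear_combination -h

/-- Bose's triple systems: many disjoint ones on `6 t + 3` points. -/
theorem exists_steiner_bose {t a : ℕ} (ha : 2 * a ≤ t) :
    ∃ f : Fin a → ZMod (2 * t + 1) × ZMod 3 → ZMod (2 * t + 1) × ZMod 3 →
        ZMod (2 * t + 1) × ZMod 3,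
      (∀ k, IsSteiner (f k)) ∧ ∀ k l x y, x ≠ y → f k x y = f l x y → k = l := by
  let h : ZMod (2 * t + 1) := ((t + 1 : ℕ) : ZMod (2 * t + 1))
  have h2 : 2 * h = 1 := by
    have : ((2 * t + 1 : ℕ) : ZMod (2 * t + 1)) = 0 := ZMod.natCast_self _
    simp only [h]
    push_cast at this ⊢
    linear_combination this
  let s : ZMod (2 * t + 1) → ZMod (2 * t + 1) → ZMod (2 * t + 1) := fun x y => h * (x + y)
  let d : ZMod (2 * t + 1) → ZMod (2 * t + 1) → ZMod (2 * t + 1) := fun x y => 2 * y - x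
  have hs : ∀ x y, s x y = s y x := fun x y => by simp only [s]; ring
  have hsd : ∀ x y, s x (d x y) = y := fun x y => by
    simp only [s, d]; linear_combination y * h2
  have hds : ∀ x y, d x (s x y) = y := fun x y => by
    simp only [s, d]; linear_combination (x + y) * h2
  have hL : ∀ x, s x x = x := fun x => by
    simp only [s]; linear_combination x * h2
  have hcan := levelOp_cancel_some (σ := id) (L := fun _ => True) hs hsd hds (fun x _ => hL x)
    (fun x hx => absurd trivial hx)
  have hsome : ∀ p q : ZMod (2 * t + 1) × ZMod 3, levelOp s d id (fun _ => True) (some p) (some q) ≠ none := by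
    intro p q e
    have := hcan p q
    rw [e] at this
    obtain ⟨x, i⟩ := p
    obtain ⟨y, j⟩ := q
    rcases level_cases i j with rfl | rfl | rfl
    · rw [levelOp_same] at e; split_ifs at e
    · rw [levelOp_up, levelUp] at e; split_ifs at e
    · rw [levelOp_down, levelUp] at e; split_ifs at e
  -- All elements being idempotent, finite points never produce infinity, so the operation restricts
  -- to them and the default `p` is never used.
  let g : ZMod (2 * t + 1) × ZMod 3 → ZMod (2 * t + 1) × ZMod 3 → ZMod (2 * t + 1) × ZMod 3 := fun p q =>
    (levelOp s d id (fun _ => True) (some p) (some q)).getD p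
  have hg : ∀ p q, some (g p q) = levelOp s d id (fun _ => True) (some p) (some q) := by
    intro p q
    obtain ⟨r, hr⟩ := Option.ne_none_iff_exists'.1 (hsome p q)
    simp only [g, hr, Option.getD_some]
  have hgs : IsSteiner g := by
    constructor
    · intro p
      apply Option.some_injective
      rw [hg, levelOp_idem]
    · intro p q
      apply Option.some_injective
      rw [hg, hg, levelOp_comm hs]
    · intro p q
      apply Option.some_injective
      rw [hg, hg, hcan]
  let e : Fin a → ZMod (2 * t + 1) × ZMod 3 ≃ ZMod (2 * t + 1) × ZMod 3 := fun k => shift fun i => ((k * i.val : ℕ) : ZMod (2 * t + 1))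
  refine ⟨fun k p q => e k (g ((e k).symm p) ((e k).symm q)), fun k => hgs.conj (e k), ?_⟩
  intro k l p q hpq heq
  by_contra hkl
  have hinc : ∀ i : ZMod 3, ((k * (i + 1).val : ℕ) : ZMod (2 * t + 1)) - ((k * i.val : ℕ) : ZMod (2 * t + 1)) ≠
      ((l * (i + 1).val : ℕ) : ZMod (2 * t + 1)) - ((l * i.val : ℕ) : ZMod (2 * t + 1)) := fun i hi =>
    hkl (Fin.ext (increment_injective (by omega) (by omega) i hi))
  refine shiftedOp_ne (s := s) (d := d) (σ := id) (L := fun _ => True)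
    (a := fun i => ((k * i.val : ℕ) : ZMod (2 * t + 1))) (b := fun i => ((l * i.val : ℕ) : ZMod (2 * t + 1))) hs hsd ?_ ?_
    (p := some p) (q := some q) (by simpa using hpq) ?_
  · intro x y i hi
    refine hinc i ?_
    simp only [s] at hi
    linear_combination hi + (((k * i.val : ℕ) : ZMod (2 * t + 1)) - ((l * i.val : ℕ) : ZMod (2 * t + 1))) * h2
  · intro x i j hij
    simp only [id] at hij
    rcases level_cases i j with rfl | rfl | rfl
    · rfl
    · exact absurd (by linear_combination hij) (hinc i)
    · exact absurd (by linear_combination -hij) (hinc j)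
  · simp only [shiftedOp_eq, Option.map_some, ← hg]
    exact congrArg some heq

/-! ### Skolem's systems and their disjoint translates -/

section Skolem

variable (t : ℕ)

/-- The half-idempotent relabelling `2 j ↦ j`, `2 j + 1 ↦ j + t` of the integers modulo `2 t`. -/
def halve (u : ZMod (2 * t)) : ZMod (2 * t) := ((u.val / 2 + u.val % 2 * t : ℕ) : ZMod (2 * t))

/-- The inverse of `halve`. -/
def unhalve (v : ZMod (2 * t)) : ZMod (2 * t) :=
  ((if v.val < t then 2 * v.val else 2 * (v.val - t) + 1 : ℕ) : ZMod (2 * t))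

variable {t} [NeZero t]

theorem halve_unhalve (v : ZMod (2 * t)) : halve t (unhalve t v) = v := by
  have hv := ZMod.val_lt v
  have e : (unhalve t v).val = if v.val < t then 2 * v.val else 2 * (v.val - t) + 1 := by
    rw [unhalve, ZMod.val_cast_of_lt]
    split_ifs <;> omega
  rw [halve, e]
  conv_rhs => rw [← ZMod.natCast_zmod_val v]
  congr 1
  split_ifs with h
  · rw [Nat.mul_mod_right, Nat.mul_div_cancel_left _ (by decide)]; omega
  · rw [show (2 * (v.val - t) + 1) % 2 = 1 by omega]; omega

theorem unhalve_halve (u : ZMod (2 * t)) : unhalve t (halve t u) = u := by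
  have hu := ZMod.val_lt u
  have e : (halve t u).val = u.val / 2 + u.val % 2 * t := by
    rw [halve, ZMod.val_cast_of_lt]
    rcases Nat.mod_two_eq_zero_or_one u.val with h | h <;> rw [h] <;> omega
  rw [unhalve, e]
  conv_rhs => rw [← ZMod.natCast_zmod_val u]
  congr 1
  rcases Nat.mod_two_eq_zero_or_one u.val with h | h <;> rw [h] <;> split_ifs <;> omega

theorem halve_add_self_of_lt {x : ZMod (2 * t)} (hx : x.val < t) : halve t (x + x) = x := by
  have e : (x + x).val = 2 * x.val := by
    rw [ZMod.val_add_of_lt (by omega)]; omega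
  rw [halve, e]
  conv_rhs => rw [← ZMod.natCast_zmod_val x]
  congr 1
  rw [Nat.mul_mod_right]; omega

theorem add_half_val_of_le {x : ZMod (2 * t)} (hx : t ≤ x.val) :
    (x + (t : ZMod (2 * t))).val = x.val - t := by
  have hv := ZMod.val_lt x
  have ht : 0 < t := Nat.pos_of_ne_zero (NeZero.ne t)
  rw [ZMod.val_add, ZMod.val_cast_of_lt (by omega),
    show x.val + t = x.val - t + 2 * t by omega, Nat.add_mod_right, Nat.mod_eq_of_lt (by omega)]

theorem add_half_val_of_lt {x : ZMod (2 * t)} (hx : x.val < t) :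
    (x + (t : ZMod (2 * t))).val = x.val + t := by
  rw [ZMod.val_add, ZMod.val_cast_of_lt (by omega), Nat.mod_eq_of_lt (by omega)]

theorem halve_add_self_of_le {x : ZMod (2 * t)} (hx : t ≤ x.val) :
    halve t (x + x) = x + (t : ZMod (2 * t)) := by
  have hv := ZMod.val_lt x
  have e : (x + x).val = 2 * (x.val - t) := by
    rw [ZMod.val_add, show x.val + x.val = 2 * (x.val - t) + 2 * t by omega, Nat.add_mod_right,
      Nat.mod_eq_of_lt (by omega)]
  rw [halve, e, ← ZMod.natCast_zmod_val (x + (t : ZMod (2 * t))), add_half_val_of_le hx]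
  congr 1
  rw [Nat.mul_mod_right]; omega

/-- Modulo `t`, `halve` is the floor of half the representative, so it turns translation by `2 * c`
into translation by `c`, although modulo `2 * t` it need not. -/
theorem castHom_halve_sub (u c : ZMod (2 * t)) :
    ZMod.castHom (Dvd.intro_left 2 rfl) (ZMod t) (halve t (u - 2 * c)) =
      ZMod.castHom (Dvd.intro_left 2 rfl) (ZMod t) (halve t u) -
        ZMod.castHom (Dvd.intro_left 2 rfl) (ZMod t) c := by
  have key : ∀ u : ZMod (2 * t), ZMod.castHom (Dvd.intro_left 2 rfl) (ZMod t) (halve t u) =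
      (((u.val : ℤ) / 2 : ℤ) : ZMod t) := by
    intro u
    rw [halve, map_natCast]
    push_cast
    rw [ZMod.natCast_self, mul_zero, add_zero, ← Int.cast_natCast]
    push_cast
    rfl
  have hc : ZMod.castHom (Dvd.intro_left 2 rfl) (ZMod t) c = ((c.val : ℤ) : ZMod t) := by
    conv_lhs => rw [← ZMod.natCast_zmod_val c, map_natCast]
    simp
  have hdvd : (((u - 2 * c).val : ℤ) : ZMod (2 * t)) = (((u.val : ℤ) - 2 * (c.val : ℤ) : ℤ) :
      ZMod (2 * t)) := by
    push_cast
    simp only [ZMod.natCast_zmod_val]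
  rw [ZMod.intCast_eq_intCast_iff_dvd_sub] at hdvd
  obtain ⟨z, hz⟩ := hdvd
  have hz' : ((u - 2 * c).val : ℤ) / 2 = (u.val : ℤ) / 2 - c.val - t * z := by
    push_cast at hz
    have : ((u - 2 * c).val : ℤ) = u.val + 2 * (-(c.val : ℤ) - t * z) := by linarith
    rw [this, Int.add_mul_ediv_left _ _ (by decide)]
    ring
  rw [key, key, hc, hz']
  push_cast
  rw [ZMod.natCast_self]
  ring

/-- Skolem's triple systems: many disjoint ones on `6 t + 1` points. -/
theorem exists_steiner_skolem {a : ℕ} (ha : 2 * a ≤ t) :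
    ∃ f : Fin a → Option (ZMod (2 * t) × ZMod 3) → Option (ZMod (2 * t) × ZMod 3) →
        Option (ZMod (2 * t) × ZMod 3),
      (∀ k, IsSteiner (f k)) ∧ ∀ k l x y, x ≠ y → f k x y = f l x y → k = l := by
  let s : ZMod (2 * t) → ZMod (2 * t) → ZMod (2 * t) := fun x y => halve t (x + y)
  let d : ZMod (2 * t) → ZMod (2 * t) → ZMod (2 * t) := fun x y => unhalve t y - x
  let σ : ZMod (2 * t) → ZMod (2 * t) := fun x => x + (t : ZMod (2 * t))
  let L : ZMod (2 * t) → Prop := fun x => x.val < t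
  have hs : ∀ x y, s x y = s y x := fun x y => by simp only [s, add_comm]
  have hsd : ∀ x y, s x (d x y) = y := fun x y => by simp [s, d, halve_unhalve]
  have hds : ∀ x y, d x (s x y) = y := fun x y => by simp [s, d, unhalve_halve]
  have tt : (t : ZMod (2 * t)) + (t : ZMod (2 * t)) = 0 := by
    have : ((2 * t : ℕ) : ZMod (2 * t)) = 0 := ZMod.natCast_self _
    push_cast at this
    linear_combination this
  have hst : IsSteiner (levelOp s d σ L) := by
    refine isSteiner_levelOp hs hsd hds (fun x hx => halve_add_self_of_lt hx) (fun x hx => ?_)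
      (fun x => ?_) (fun x hx => ?_)
    · have hx' : t ≤ x.val := not_lt.1 hx
      refine ⟨halve_add_self_of_le hx', ?_⟩
      have := ZMod.val_lt x
      simp only [L, σ, add_half_val_of_le hx']
      omega
    · simp only [σ, add_assoc, tt, add_zero]
    · simp only [L, σ, add_half_val_of_lt hx]
      omega
  let c : Fin a → ZMod 3 → ZMod (2 * t) := fun k i => ((k * i.val : ℕ) : ZMod (2 * t))
  refine ⟨fun k => shiftedOp s d σ L (c k), fun k => hst.conj _, ?_⟩
  intro k l p q hpq heq
  by_contra hkl
  -- Increments are compared modulo `t`, where `halve` respects translations and `σ` becomes the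
  -- identity; hence the requirement `2 * a ≤ t`.
  let r := ZMod.castHom (Dvd.intro_left 2 rfl : t ∣ 2 * t) (ZMod t)
  have hinc : ∀ i : ZMod 3, r (c k (i + 1)) - r (c k i) ≠ r (c l (i + 1)) - r (c l i) := by
    intro i hi
    simp only [c, map_natCast] at hi
    exact hkl (Fin.ext (increment_injective (by omega) (by omega) i hi))
  refine shiftedOp_ne hs hsd ?_ ?_ hpq heq
  · intro x y i hi
    refine hinc i ?_
    have e := congrArg r hi
    simp only [s, map_add] at e
    have h1 : ∀ z : ZMod (2 * t), x - z + (y - z) = (x + y) - 2 * z := fun z => by ring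
    rw [h1, h1, castHom_halve_sub, castHom_halve_sub] at e
    linear_combination e
  · intro x i j hij
    have e := congrArg r hij
    simp only [σ, map_add, map_sub] at e
    rcases level_cases i j with rfl | rfl | rfl
    · rfl
    · exact absurd (by linear_combination e) (hinc i)
    · exact absurd (by linear_combination -e) (hinc j)

end Skolem

/-! ### The extremal matrix and the conclusion -/

/-- Simple triple systems of small index exist on `m ≡ 1, 3 (mod 6)` points. -/
theorem exists_simple_triples {m a : ℕ} (hm : m % 6 = 1 ∨ m % 6 = 3) (ha : 12 * a + 6 < m) :
    ∃ T : Finset (Finset (Fin m)), (∀ U ∈ T, #U = 3) ∧ ∀ P, #P = 2 → #{U ∈ T | P ⊆ U} = a := by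
  have transport : ∀ (V : Type) [Fintype V], Fintype.card V = m →
      (∃ f : Fin a → V → V → V, (∀ k, IsSteiner (f k)) ∧
        ∀ k l x y, x ≠ y → f k x y = f l x y → k = l) →
      ∃ T : Finset (Finset (Fin m)), (∀ U ∈ T, #U = 3) ∧
        ∀ P, #P = 2 → #{U ∈ T | P ⊆ U} = a := by
    rintro V _ hV ⟨f, hf, hne⟩
    let e : V ≃ Fin m := Fintype.equivFinOfCardEq hV
    refine exists_triples (fun k x y => e (f k (e.symm x) (e.symm y))) (fun k => (hf k).conj e) ?_
    intro k l x y hxy h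
    exact hne k l _ _ (e.symm.injective.ne hxy) (e.injective h)
  rcases hm with h | h
  · obtain ⟨t, rfl⟩ : ∃ t, m = 6 * t + 1 := ⟨m / 6, by omega⟩
    have : NeZero t := ⟨by omega⟩
    refine transport (Option (ZMod (2 * t) × ZMod 3)) ?_ (exists_steiner_skolem (by omega))
    rw [Fintype.card_option, Fintype.card_prod, ZMod.card, ZMod.card]
    ring
  · obtain ⟨t, rfl⟩ : ∃ t, m = 6 * t + 3 := ⟨m / 6, by omega⟩
    refine transport (ZMod (2 * t + 1) × ZMod 3) ?_ (exists_steiner_bose (by omega))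
    rw [Fintype.card_prod, ZMod.card, ZMod.card]
    ring

theorem card_extreme_sets {m : ℕ} (hm : 6 ≤ m) :
    #{U : Finset (Fin m) | #U ∈ extremeSums m} = 2 * (m + 1) + 2 * m.choose 2 := by
  have hsub : extremeSums m ⊆ range (m + 1) := by
    intro s hs
    simp only [extremeSums, mem_insert, mem_singleton] at hs
    rw [mem_range]
    omega
  have c1 : m.choose (m - 1) = m := by
    rw [Nat.choose_symm (by omega), Nat.choose_one_right]
  have c2 : m.choose (m - 2) = m.choose 2 := Nat.choose_symm (by omega)
  rw [card_filter, ← powerset_univ,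
    sum_powerset_apply_card (fun s => if s ∈ extremeSums m then 1 else 0), card_univ,
    Fintype.card_fin, ← sum_subset hsub fun s _ hs => by simp [hs],
    sum_congr rfl fun s hs => by rw [if_pos hs, smul_eq_mul, mul_one]]
  unfold extremeSums
  rw [sum_insert, sum_insert, sum_insert, sum_insert, sum_insert, sum_singleton, c1, c2]
  · simp; ring
  all_goals simp only [mem_insert, mem_singleton]; omega

/-- The simple matrix whose columns are the extreme columns and the triples of a design. -/
theorem exists_extremal_matrix {q m : ℕ} (hq : 2 < q) (hV : 1000 * q ^ 2 < m)
    (hm : m % 6 = 1 ∨ m % 6 = 3) :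
    ∃ (n : ℕ) (A : Matrix (Fin m) (Fin n) (Fin 2)),
      3 * n = (q + 3) * m.choose 2 + 6 * (m + 1) ∧ IsSimple A ∧
        ¬ HasConfiguration A (copies q 2 2) := by
  obtain ⟨T, hT3, hT⟩ := exists_simple_triples (a := q - 3) hm (by nlinarith [Nat.sub_le q 3])
  have hm6 : 1000 < m := by nlinarith
  let E : Finset (Finset (Fin m)) := {U | #U ∈ extremeSums m}
  have hdisj : Disjoint E T := by
    rw [disjoint_left]
    intro U hU hUT
    simp only [E, mem_filter, mem_univ, true_and, hT3 U hUT, extremeSums, mem_insert,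
      mem_singleton] at hU
    omega
  have hcardT : 3 * #T = (q - 3) * m.choose 2 :=
    (isTripleSystem_of_countP (T := T.val) (a := q - 3) hT3 fun P hP => by
      rw [Multiset.countP_eq_card_filter]; exact hT P hP).card_eq
  let col : Fin #(E ∪ T) ≃ ↥(E ∪ T) := (E ∪ T).equivFin.symm
  let A : Matrix (Fin m) (Fin #(E ∪ T)) (Fin 2) := fun i j => if i ∈ (col j).1 then 1 else 0
  have hcol : ∀ j, colSet A j = (col j).1 := fun j => support_indicator _
  have hinj : Function.Injective (colSet A) := by
    intro j k h
    rw [hcol, hcol] at h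
    exact col.injective (Subtype.ext h)
  refine ⟨#(E ∪ T), A, ?_, ?_, ?_⟩
  · rw [card_union_of_disjoint hdisj, mul_add, hcardT, card_extreme_sets (by omega)]
    obtain ⟨p, rfl⟩ := Nat.exists_eq_add_of_lt hq
    rw [show 2 + p + 1 - 3 = p by omega]
    ring
  · intro j k h
    exact hinj (congrArg support (funext h))
  · rw [hasConfiguration_copies]
    rintro ⟨P, Q, hP, hQ, hPQ, hle⟩
    -- Among the extreme columns only `P` and the complement of `Q` can split the two pairs. With
    -- the `q - 3` triples through `P` this makes at most `q - 1` columns.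
    have h1 : splitCount (colSet A) P Q ≤ #({P, Qᶜ} ∪ ({U ∈ T | P ⊆ U} : Finset _)) := by
      refine card_le_card_of_injOn (colSet A) ?_ hinj.injOn
      intro j hj
      simp only [coe_filter, mem_univ, true_and, Set.mem_ofPred_eq] at hj
      have hmem := (col j).2
      rw [← hcol j] at hmem
      rw [mem_coe, mem_union]
      rcases mem_union.1 hmem with h | h
      · left
        have l1 := card_le_card hj.1
        have l2 := card_le_card hj.2
        rw [card_compl, Fintype.card_fin, hQ] at l2
        rw [hP] at l1
        simp only [E, mem_filter, mem_univ, true_and, extremeSums, mem_insert,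
          mem_singleton] at h
        have hcases : #(colSet A j) = 2 ∨ #(colSet A j) = m - 2 := by omega
        rw [mem_insert, mem_singleton]
        rcases hcases with h | h
        · left
          exact (eq_of_subset_of_card_le hj.1 (by omega)).symm
        · right
          refine eq_of_subset_of_card_le (subset_compl_comm.1 hj.2) ?_
          rw [card_compl, Fintype.card_fin, hQ, h]
      · right
        exact mem_filter.2 ⟨h, hj.1⟩
    have h2 := card_union_le {P, Qᶜ} ({U ∈ T | P ⊆ U} : Finset _)
    have h3 : #({P, Qᶜ} : Finset (Finset (Fin m))) ≤ 2 := card_le_two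
    have h4 := hT P hP
    omega

theorem IsSimple.noRepeatedExtremeColumn {m n : ℕ} {A : Matrix (Fin m) (Fin n) (Fin 2)}
    (hA : IsSimple A) : NoRepeatedExtremeColumn A := fun j k _ h => hA j k h

end ForbConfig

theorem proposition7 (q : ℕ) (hq : 2 < q) :
    ∃ M : ℕ, ∀ m : ℕ, M < m →
      (∀ (n : ℕ) (A : Matrix (Fin m) (Fin n) (Fin 2)),
        ForbConfig.NoRepeatedExtremeColumn A →
        ¬ ForbConfig.HasConfiguration A (ForbConfig.copies q 2 2) →
        (n : ℚ) ≤ 2 * m + 2 + ((q : ℚ) + 3) / 3 * (m.choose 2 : ℚ)) ∧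
      (m % 6 = 1 ∨ m % 6 = 3 →
        (ForbConfig.forb m (ForbConfig.copies q 2 2) : ℚ) =
          2 * m + 2 + ((q : ℚ) + 3) / 3 * (m.choose 2 : ℚ) ∧
        (∃ A : Matrix (Fin m) (Fin (ForbConfig.forb m (ForbConfig.copies q 2 2))) (Fin 2),
          ForbConfig.IsSimple A ∧
          ¬ ForbConfig.HasConfiguration A (ForbConfig.copies q 2 2)) ∧
        ∀ (n : ℕ) (A : Matrix (Fin m) (Fin n) (Fin 2)),
          ForbConfig.NoRepeatedExtremeColumn A →
          ¬ ForbConfig.HasConfiguration A (ForbConfig.copies q 2 2) →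
          n = ForbConfig.forb m (ForbConfig.copies q 2 2) →
          ForbConfig.IsDesignMatrix q A) := by
  refine ⟨1000 * q ^ 2, fun m hm => ⟨fun n A hA hF => ?_, fun hmod => ?_⟩⟩
  · have h : ((3 * n : ℕ) : ℚ) ≤ (((q + 3) * m.choose 2 + 6 * (m + 1) : ℕ) : ℚ) := by
      exact_mod_cast (ForbConfig.columns_bound hq hm hA hF).1
    push_cast at h
    linarith
  · obtain ⟨n₀, A₀, hn₀, hA₀, hF₀⟩ := ForbConfig.exists_extremal_matrix hq hm hmod
    have hmem : n₀ ∈ {N : ℕ | ∀ (n : ℕ) (A : Matrix (Fin m) (Fin n) (Fin 2)),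
        ForbConfig.IsSimple A → ¬ ForbConfig.HasConfiguration A (ForbConfig.copies q 2 2) →
        n ≤ N} := by
      intro n A hA hF
      have := (ForbConfig.columns_bound hq hm hA.noRepeatedExtremeColumn hF).1
      omega
    have hforb : ForbConfig.forb m (ForbConfig.copies q 2 2) = n₀ :=
      le_antisymm (Nat.sInf_le hmem) (Nat.sInf_mem ⟨n₀, hmem⟩ n₀ A₀ hA₀ hF₀)
    rw [hforb]
    refine ⟨?_, ⟨A₀, hA₀, hF₀⟩, ?_⟩
    · have h : ((3 * n₀ : ℕ) : ℚ) = (((q + 3) * m.choose 2 + 6 * (m + 1) : ℕ) : ℚ) := by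
        exact_mod_cast hn₀
      push_cast at h
      linarith
    · rintro n A hA hF rfl
      exact (ForbConfig.columns_bound hq hm hA hF).2 hn₀
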